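/- Let $D$ be an oriented link diagram with $n$ crossings representing a link $L$. Resolve each crossing by the $0$-resolution, which joins the two regions swept by the overstrand when it is turned counterclockwise, or by the $1$-resolution, which joins the other two. For $\alpha\in\{0,1\}^n$ let $D_\alpha$ be the resulting collection of $c(\alpha)$ circles, let $V(D_\alpha)$ be the free abelian group on these circles, and let $\deg\alpha$ be the number of ones in $\alpha$. The odd Khovanov complex of $D$ has in degree $i$ the group $\bigoplus_{\deg\alpha=i+n_-}\Lambda^*V(D_\alpha)$, where $n_-$ is the number of negative crossings. To define its differential, choose at each crossing an arrow between the two arcs of the $0$-resolution. Changing a $0$-resolution to a $1$-resolution either merges two circles, and is assigned the quotient map $\Lambda^*V(D_\alpha)\to\Lambda^*V(D_{\alpha'})$ that identifies them, or splits a circle into $c_0',c_1'$, and is assigned the map that lifts along the identification of $c_0'$ and $c_1'$ and then multiplies from the left by $c_0'-c_1'$; here the arrow turned clockwise by $90$ degrees points from $c_0'$ to $c_1'$. The differential is the sum of all these maps, each multiplied by its sign in a valid sign assignment of type Y. That is, every edge of the cube has a sign such that every signed two-dimensional face anticommutes; and on the faces where both composites split one circle and merge it again (so that both composites vanish on exterior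 algebras) the product of the four signs is $+1$ or $-1$ as follows. On such a face the two arrows are attached to a single circle of $D_\alpha$ from its two sides, with alternating ends. Walk along the circle from the tail of one arrow to its head, with this arrow on the left: the product is $+1$ if one passes the head of the other arrow, and $-1$ if one passes its tail. The odd Khovanov homology $\mathrm{Okh}(L)$ is the homology of this complex. Let $\mathrm{Col}(D)$ be the free abelian group on the edges of $D$ (as a $4$-valent graph; a component without crossings counts as one edge) modulo the following relations: at each crossing the two edges of the overstrand are equal, and if $e_i$ is an edge of the overstrand and $e_j,e_k$ are the two edges of the understrand at that crossing, then $2e_i-e_j-e_k=0$. For an edge $e$ of $D$ let $\Phi_e$ be the map of the identity cobordism with a dot on $e$: on $\Lambda^*V(D_\alpha)$ it is $(-1)^{S(\alpha)}$ times left multiplication by the circle of $D_\alpha$ that contains $e$, where $S(\alpha)=\tfrac12\bigl(c(\alpha)+c(0,\dots,0)+\deg\alpha\bigr)$. Theorem. For every choice of the arrows and of the valid sign assignment, each $\Phi_e$ is a chain map of the odd Khovanov complex of $D$, and $\mathrm{Okh}(L)$ is, in each homological degree, a module over the exterior algebra $\Lambda^*\mathrm{Col}(D)$ in such a way that the class of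 each edge $e$ acts by the map that $\Phi_e$ induces on homology. -/

import Mathlib

/-- A half-edge at one of `n` crossings: the crossing and the position of the half-edge there. The
four positions `0, 1, 2, 3` are arranged counterclockwise around the crossing. The under strand
joins the positions `0` and `2`, the over strand joins `1` and `3`. -/
abbrev HalfEdge (n : ℕ) : Type := Fin n × Fin 4

/-- Whether the half-edge is directed away from its crossing. The under strand always runs from
position `0` to position `2`. The over strand runs from `3` to `1` at a positive crossing, and from
`1` to `3` at a negative crossing. -/
def isOutgoing {n : ℕ} (positive : Fin n → Bool) (h : HalfEdge n) : Bool :=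
  if h.2 = 0 then false
  else if h.2 = 1 then positive h.1
  else if h.2 = 2 then true
  else !positive h.1

/-- The regions at a 4-valent map on a closed oriented surface: orbits of corners. The half-edge
`(x, k)` also stands for the corner between the positions `k` and `k + 1` at `x`, which is the one
on the left of this half-edge when one leaves the crossing. At the other end of the edge
it continues as the corner on the right of the opposite half-edge. -/
def MapFaces {n : ℕ} (opp : HalfEdge n → HalfEdge n) : Type :=
  Quot fun h h' : HalfEdge n => h' = ((opp h).1, (opp h).2 - 1)

/-- The connected components of a 4-valent graph. -/
def MapComponents {n : ℕ} (opp : HalfEdge n → HalfEdge n) : Type :=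
  Quot fun x y : Fin n => ∃ h : HalfEdge n, h.1 = x ∧ (opp h).1 = y

/-- An oriented link diagram with numbered crossings, up to planar isotopy: a planar 4-valent map
with over/under information (the labelling of the half-edges), together with finitely many
components without crossings. -/
structure LinkDiagram where
  /-- the number of crossings -/
  n : ℕ
  /-- the number of components of the diagram which are circles without crossings -/
  loops : ℕ
  /-- the sign of each crossing -/
  positive : Fin n → Bool
  /-- the other half of the edge to which a half-edge belongs -/
  opp : HalfEdge n → HalfEdge n
  opp_opp : ∀ h, opp (opp h) = h
  /-- each edge is directed from one of its ends to the other one -/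
  oriented : ∀ h, isOutgoing positive (opp h) = !isOutgoing positive h
  /-- Euler's formula: each connected component lies on a sphere (there are `n` vertices and
  `2 * n` edges, and no component has Euler characteristic above `2`) -/
  planar : Nat.card (MapFaces opp) = n + 2 * Nat.card (MapComponents opp)

namespace LinkDiagram

variable (D : LinkDiagram)

/-- The edges of the diagram: pairs of opposite half-edges, and the circles without crossings. -/
def Edge : Type := (Quot fun h h' : HalfEdge D.n => h' = D.opp h) ⊕ Fin D.loops

/-- The edge at position `k` of the crossing `x`. -/
def edge (x : Fin D.n) (k : Fin 4) : D.Edge := Sum.inl (Quot.mk _ (x, k))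

/-! ### The coloring group -/

/-- The relations of the coloring group: edges separated by an overcrossing are equal, and twice the
over edge is the sum of the two under edges. -/
def coloringRelations : Set (D.Edge →₀ ℤ) :=
  {r | ∃ x : Fin D.n,
    r = Finsupp.single (D.edge x 1) 1 - Finsupp.single (D.edge x 3) 1 ∨
    r = (2 : ℤ) • Finsupp.single (D.edge x 1) 1 - Finsupp.single (D.edge x 0) 1
      - Finsupp.single (D.edge x 2) 1}

/-- The coloring group `Col(D)`. -/
abbrev Col : Type := (D.Edge →₀ ℤ) ⧸ Submodule.span ℤ D.coloringRelations

/-- The class of an edge in the coloring group. -/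
noncomputable def colClass (e : D.Edge) : D.Col := Submodule.Quotient.mk (Finsupp.single e 1)

/-! ### Resolutions -/

/-- A vertex of the cube of resolutions; `false` stands for `0` and `true` for `1`. -/
abbrev State : Type := Fin D.n → Bool

/-- The number of crossings with resolution `1`. -/
def deg (α : D.State) : ℕ := (Finset.univ.filter fun x => α x = true).card

/-- The state which differs from `α` in having resolution `1` at `x`. -/
def flip (α : D.State) (x : Fin D.n) : D.State := Function.update α x true

/-- Two edges are joined by an arc of the resolved diagram `D_α` near a crossing. The resolution `0`
joins the two regions which the over strand sweeps when it is turned counterclockwise (those between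
positions `1, 2` and between `3, 0`), so that its arcs are `01` and `23`; the arcs of the
resolution `1` are `03` and `12`. -/
def Joined (α : D.State) (e e' : D.Edge) : Prop :=
  ∃ x : Fin D.n,
    (α x = false ∧
      ((e = D.edge x 0 ∧ e' = D.edge x 1) ∨ (e = D.edge x 2 ∧ e' = D.edge x 3))) ∨
    (α x = true ∧
      ((e = D.edge x 0 ∧ e' = D.edge x 3) ∨ (e = D.edge x 1 ∧ e' = D.edge x 2)))

/-- The circles of the resolved diagram `D_α`. -/
def Circle (α : D.State) : Type := Quot (D.Joined α)

/-- The circle of `D_α` on which an edge lies. -/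
def circle (α : D.State) (e : D.Edge) : D.Circle α := Quot.mk _ e

/-- The free abelian group `V(D_α)` on the circles of `D_α`. -/
abbrev V (α : D.State) : Type := D.Circle α →₀ ℤ

/-- The group at the vertex `α` of the cube: the exterior algebra of `V(D_α)`. -/
abbrev Lam (α : D.State) : Type := ExteriorAlgebra ℤ (D.V α)

/-- The circle of `D_α` through the edge `e`, as an element of the exterior algebra. -/
noncomputable def gen (α : D.State) (e : D.Edge) : D.Lam α :=
  ExteriorAlgebra.ι ℤ (Finsupp.single (D.circle α e) 1)

/-! ### The edges of the cube

A crossing orientation is an arrow at each crossing between the regions `01` and `23`, that is,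
between the two arcs of the resolution `0`. `o x = false` stands for the arrow from the arc `01` to
the arc `23`, and `o x = true` for the opposite arrow. -/

/-- An edge of the diagram at the tail of the arrow at `x` (it lies on the arc of the
resolution `0` from which the arrow starts). -/
def tailEdge (o : Fin D.n → Bool) (x : Fin D.n) : D.Edge := bif o x then D.edge x 2 else D.edge x 0

/-- An edge on the arc of the resolution `1` at `x` from which the arrow starts that is obtained by
turning the arrow at `x` clockwise by ninety degrees: the arc `03` for the arrow from `01` to `23`. -/
def rotTailEdge (o : Fin D.n → Bool) (x : Fin D.n) : D.Edge :=
  bif o x then D.edge x 1 else D.edge x 3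

/-- An edge on the arc of the resolution `1` at `x` to which the turned arrow points: the arc `12`
for the arrow from `01` to `23`. -/
def rotHeadEdge (o : Fin D.n → Bool) (x : Fin D.n) : D.Edge :=
  bif o x then D.edge x 3 else D.edge x 1

/-- At the vertex `α` (with `α x = 0`), changing the resolution of `x` merges two circles.
Otherwise it splits a circle. -/
def IsMerge (α : D.State) (x : Fin D.n) : Prop :=
  D.circle α (D.edge x 0) ≠ D.circle α (D.edge x 2)

/-- The map which sends each circle of `D_α` to a circle of `D_β` that shares an edge with it. If
`D_β` arises from `D_α` by a merge, there is only one such circle. If it arises by a split, then the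
only choice is between the two parts of the circle which is split. -/
noncomputable def transport (α β : D.State) : D.Circle α → D.Circle β :=
  fun c => D.circle β (Quot.out c)

/-- The homomorphism of exterior algebras induced by `transport`. -/
noncomputable def transportMap (α β : D.State) : D.Lam α →ₗ[ℤ] D.Lam β :=
  (ExteriorAlgebra.map (Finsupp.lmapDomain ℤ ℤ (D.transport α β))).toLinearMap

open Classical in
/-- The map of the saddle cobordism from `D_α` to `D_β`, where `β` arises from `α` by
changing the resolution of `x` from `0` to `1`. A merge identifies two circles. A split
is an arbitrary lift along the identification of the two new circles `c₀'` and `c₁'`, followed by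
left multiplication with `c₀' - c₁'` (the result does not depend on the lift); the turned arrow
points from `c₀'` to `c₁'`. -/
noncomputable def saddle (o : Fin D.n → Bool) (x : Fin D.n) (α β : D.State) :
    D.Lam α →ₗ[ℤ] D.Lam β :=
  if D.IsMerge α x then D.transportMap α β
  else
    (LinearMap.mulLeft ℤ (D.gen β (D.rotTailEdge o x) - D.gen β (D.rotHeadEdge o x))).comp
      (D.transportMap α β)

/-! ### Sign assignments -/

/-- The two-dimensional face at `α` in the directions `x` and `y` is of type X or Y: one circle
is split into two along `x`, and these are merged again along `y`, and the same with `x` and `y`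
exchanged. These are the faces along which both composite maps vanish. -/
def IsTypeXY (α : D.State) (x y : Fin D.n) : Prop :=
  ¬ D.IsMerge α x ∧ ¬ D.IsMerge α y ∧ D.IsMerge (D.flip α x) y ∧ D.IsMerge (D.flip α y) x

/-- Among the faces with `IsTypeXY`, those which anticommute by convention (type Y). The two arrows
are attached to a single circle, from the two sides, and their ends alternate along the circle. Walk
along the circle from the tail of the arrow at `x` to its head, with this arrow on the left. In
type X one passes the tail of the arrow at `y`, in type Y its head. In other words, after the
splitting along `x`, in type Y the tail of the arrow at `y` lies on the circle `c₀'`. -/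
def IsTypeY (o : Fin D.n → Bool) (α : D.State) (x y : Fin D.n) : Prop :=
  D.circle (D.flip α x) (D.tailEdge o y) = D.circle (D.flip α x) (D.rotTailEdge o x)

/-- A valid sign assignment (of type Y) `ε`, where `ε α x` is the sign of the edge of the cube which
starts at `α` (with `α x = 0`) and changes the resolution of `x`. All faces of the
signed cube anticommute. On faces of type X and Y, where both composites vanish after passing to
exterior algebras, this means that the product of the four signs is `-1` for the commuting type X
and `1` for the anticommuting type Y. -/
structure IsValidSign (o : Fin D.n → Bool) (ε : D.State → Fin D.n → ℤˣ) : Prop where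
  anticommute : ∀ (α : D.State) (x y : Fin D.n), x ≠ y → α x = false → α y = false →
    (ε α x * ε (D.flip α x) y) •
        (D.saddle o y (D.flip α x) (D.flip (D.flip α x) y)).comp (D.saddle o x α (D.flip α x)) +
      (ε α y * ε (D.flip α y) x) •
        (D.saddle o x (D.flip α y) (D.flip (D.flip α x) y)).comp (D.saddle o y α (D.flip α y)) = 0
  typeX : ∀ (α : D.State) (x y : Fin D.n), x ≠ y → α x = false → α y = false →
    D.IsTypeXY α x y → ¬ D.IsTypeY o α x y →
      ε α x * ε (D.flip α x) y * ε α y * ε (D.flip α y) x = -1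
  typeY : ∀ (α : D.State) (x y : Fin D.n), x ≠ y → α x = false → α y = false →
    D.IsTypeXY α x y → D.IsTypeY o α x y →
      ε α x * ε (D.flip α x) y * ε α y * ε (D.flip α y) x = 1

/-! ### The odd Khovanov complex -/

/-- The number of negative crossings. -/
def nNeg : ℕ := (Finset.univ.filter fun x => D.positive x = false).card

/-- The vertices of the cube in homological degree `i`. -/
abbrev StateIn (i : ℤ) : Type := {α : D.State // (D.deg α : ℤ) = i + D.nNeg}

/-- The chain group in homological degree `i`. -/
abbrev Chain (i : ℤ) : Type := ∀ α : D.StateIn i, D.Lam α.1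

open Classical in
/-- The component `Chain i → Chain j` of the differential: the sum of all the signed maps on
edges of the cube (there are none unless `j = i + 1`). -/
noncomputable def diff (o : Fin D.n → Bool) (ε : D.State → Fin D.n → ℤˣ) (i j : ℤ) :
    D.Chain i →ₗ[ℤ] D.Chain j :=
  LinearMap.pi fun β => ∑ α : D.StateIn i, ∑ x : Fin D.n,
    if α.1 x = false ∧ β.1 = D.flip α.1 x then
      ε α.1 x • (D.saddle o x α.1 β.1).comp (LinearMap.proj α)
    else 0

variable {D}

lemma flip_flip_comm (α : D.State) {x y : Fin D.n} (h : x ≠ y) :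
    D.flip (D.flip α x) y = D.flip (D.flip α y) x := by
  unfold flip
  exact Function.update_comm h _ _ α

lemma flip_apply_eq_false_iff (α : D.State) (x y : Fin D.n) :
    D.flip α x y = false ↔ x ≠ y ∧ α y = false := by
  unfold flip
  rcases eq_or_ne y x with rfl | h
  · simp
  · simp [Function.update_of_ne h, h.symm]

lemma deg_flip (α : D.State) (x : Fin D.n) (h : α x = false) : D.deg (D.flip α x) = D.deg α + 1 := by
  unfold deg
  rw [← Finset.card_insert_of_notMem (a := x) (s := Finset.univ.filter fun x => α x = true)
    (by simp [h])]
  congr 1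
  ext y
  unfold flip
  rcases eq_or_ne y x with rfl | hy
  · simp
  · simp [hy]

lemma diff_apply (o : Fin D.n → Bool) (ε : D.State → Fin D.n → ℤˣ) (i j : ℤ) (f : D.Chain i)
    (β : D.StateIn j) :
    D.diff o ε i j f β = ∑ α : D.StateIn i, ∑ x : Fin D.n,
      if α.1 x = false ∧ β.1 = D.flip α.1 x then ε α.1 x • D.saddle o x α.1 β.1 (f α) else 0 := by
  classical
  simp only [diff, LinearMap.pi_apply, LinearMap.sum_apply]
  refine Finset.sum_congr rfl fun α _ => Finset.sum_congr rfl fun x _ => ?_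
  split_ifs <;> simp

lemma diff_eq_zero (o : Fin D.n → Bool) (ε : D.State → Fin D.n → ℤˣ) {i j : ℤ} (h : i + 1 ≠ j) :
    D.diff o ε i j = 0 := by
  refine LinearMap.ext fun f => funext fun β => ?_
  rw [diff_apply]
  refine Finset.sum_eq_zero fun α _ => Finset.sum_eq_zero fun x _ => if_neg ?_
  rintro ⟨hx, hβ⟩
  have h1 := deg_flip α.1 x hx
  have h2 := α.2
  have h3 := β.2
  rw [hβ, h1] at h3
  push_cast at h3
  omega

lemma diff_comp_diff {o : Fin D.n → Bool} {ε : D.State → Fin D.n → ℤˣ} (hε : D.IsValidSign o ε)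
    (i : ℤ) : (D.diff o ε (i + 1) (i + 1 + 1)).comp (D.diff o ε i (i + 1)) = 0 := by
  classical
  refine LinearMap.ext fun f => funext fun γ => ?_
  rw [LinearMap.comp_apply, diff_apply]
  simp only [diff_apply]
  have key : ∀ α : D.StateIn i, ∑ x : Fin D.n, ∑ y : Fin D.n,
      (if α.1 x = false ∧ (D.flip α.1 x y = false ∧ γ.1 = D.flip (D.flip α.1 x) y) then
        (ε α.1 x * ε (D.flip α.1 x) y) •
          D.saddle o y (D.flip α.1 x) γ.1 (D.saddle o x α.1 (D.flip α.1 x) (f α)) else 0) = 0 := by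
    intro α
    rw [← Finset.sum_product']
    refine Finset.sum_involution (fun p _ => (p.2, p.1)) ?_ ?_ (by simp) (by simp)
    · rintro ⟨x, y⟩ -
      by_cases h : α.1 x = false ∧ (D.flip α.1 x y = false ∧ γ.1 = D.flip (D.flip α.1 x) y)
      · obtain ⟨hx, hy, hγ⟩ := h
        obtain ⟨hxy, hy'⟩ := (flip_apply_eq_false_iff _ _ _).1 hy
        have hyx : D.flip α.1 y x = false := (flip_apply_eq_false_iff _ _ _).2 ⟨hxy.symm, hx⟩
        have hγ' : γ.1 = D.flip (D.flip α.1 y) x := hγ.trans (flip_flip_comm _ hxy)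
        simp only [if_pos (show _ ∧ _ ∧ _ from ⟨hx, hy, hγ⟩),
          if_pos (show _ ∧ _ ∧ _ from ⟨hy', hyx, hγ'⟩)]
        have := LinearMap.congr_fun (hε.anticommute α.1 x y hxy hx hy') (f α)
        rw [← hγ] at this
        simpa using this
      · have h' : ¬ (α.1 y = false ∧ (D.flip α.1 y x = false ∧
            γ.1 = D.flip (D.flip α.1 y) x)) := by
          rintro ⟨hy, hx, hγ⟩
          obtain ⟨hyx, hx'⟩ := (flip_apply_eq_false_iff _ _ _).1 hx
          exact h ⟨hx', (flip_apply_eq_false_iff _ _ _).2 ⟨hyx.symm, hy⟩,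
            hγ.trans (flip_flip_comm _ hyx)⟩
        simp only [if_neg h, if_neg h', add_zero]
    · rintro ⟨x, y⟩ - hne heq
      apply hne
      have hxy : y = x := congrArg Prod.fst heq
      subst hxy
      refine if_neg ?_
      rintro ⟨-, h, -⟩
      exact ((flip_apply_eq_false_iff _ _ _).1 h).1 rfl
  have step : ∀ (α : D.StateIn i) (x : Fin D.n), ∑ y : Fin D.n,
      (if α.1 x = false ∧ (D.flip α.1 x y = false ∧ γ.1 = D.flip (D.flip α.1 x) y) then
        (ε α.1 x * ε (D.flip α.1 x) y) •
          D.saddle o y (D.flip α.1 x) γ.1 (D.saddle o x α.1 (D.flip α.1 x) (f α)) else 0) =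
      ∑ β : D.StateIn (i + 1), ∑ y : Fin D.n,
        if β.1 y = false ∧ γ.1 = D.flip β.1 y then
          ε β.1 y • D.saddle o y β.1 γ.1
            (if α.1 x = false ∧ β.1 = D.flip α.1 x then ε α.1 x • D.saddle o x α.1 β.1 (f α)
              else 0) else 0 := by
    intro α x
    by_cases hx : α.1 x = false
    · have hd : (D.deg (D.flip α.1 x) : ℤ) = i + 1 + D.nNeg := by
        rw [deg_flip _ _ hx]
        push_cast
        rw [α.2]
        ring
      rw [Finset.sum_eq_single_of_mem (⟨D.flip α.1 x, hd⟩ : D.StateIn (i + 1))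
        (Finset.mem_univ _)]
      · refine Finset.sum_congr rfl fun y _ => ?_
        simp only [hx, true_and, if_true]
        split_ifs
        · rw [LinearMap.map_smul_of_tower, smul_smul, mul_comm]
        · rfl
      · intro β _ hβ
        refine Finset.sum_eq_zero fun y _ => ?_
        have : ¬ (α.1 x = false ∧ β.1 = D.flip α.1 x) := fun h => hβ (Subtype.ext h.2)
        simp [this]
    · simp [hx]
  have total : ∑ β : D.StateIn (i + 1), ∑ y : Fin D.n,
      (if β.1 y = false ∧ γ.1 = D.flip β.1 y then
        ε β.1 y • D.saddle o y β.1 γ.1 (∑ α : D.StateIn i, ∑ x : Fin D.n,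
          if α.1 x = false ∧ β.1 = D.flip α.1 x then ε α.1 x • D.saddle o x α.1 β.1 (f α) else 0)
        else 0) =
      ∑ α : D.StateIn i, ∑ x : Fin D.n, ∑ β : D.StateIn (i + 1), ∑ y : Fin D.n,
        if β.1 y = false ∧ γ.1 = D.flip β.1 y then
          ε β.1 y • D.saddle o y β.1 γ.1
            (if α.1 x = false ∧ β.1 = D.flip α.1 x then ε α.1 x • D.saddle o x α.1 β.1 (f α)
              else 0) else 0 := by
    have : ∀ (β : D.StateIn (i + 1)) (y : Fin D.n),
        (if β.1 y = false ∧ γ.1 = D.flip β.1 y then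
          ε β.1 y • D.saddle o y β.1 γ.1 (∑ α : D.StateIn i, ∑ x : Fin D.n,
            if α.1 x = false ∧ β.1 = D.flip α.1 x then ε α.1 x • D.saddle o x α.1 β.1 (f α)
              else 0) else 0) =
        ∑ α : D.StateIn i, ∑ x : Fin D.n,
          if β.1 y = false ∧ γ.1 = D.flip β.1 y then
            ε β.1 y • D.saddle o y β.1 γ.1
              (if α.1 x = false ∧ β.1 = D.flip α.1 x then ε α.1 x • D.saddle o x α.1 β.1 (f α)
                else 0) else 0 := by
      intro β y
      split_ifs
      · simp only [map_sum, Finset.smul_sum]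
      · simp
    simp only [this]
    rw [Finset.sum_congr rfl fun β _ => Finset.sum_comm, Finset.sum_comm]
    refine Finset.sum_congr rfl fun α _ => ?_
    rw [Finset.sum_congr rfl fun β _ => Finset.sum_comm, Finset.sum_comm]
  refine total.trans (Finset.sum_eq_zero fun α _ => ?_)
  refine Eq.trans ?_ (key α)
  exact Finset.sum_congr rfl fun x _ => (step α x).symm

variable (D)

/-- The odd Khovanov complex of the diagram `D`, for a crossing orientation `o` and a valid sign
assignment `ε`. -/
noncomputable def oddKhovanovComplex (o : Fin D.n → Bool) (ε : D.State → Fin D.n → ℤˣ)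
    (hε : D.IsValidSign o ε) : CochainComplex (ModuleCat ℤ) ℤ where
  X i := ModuleCat.of ℤ (D.Chain i)
  d i j := ModuleCat.ofHom (D.diff o ε i j)
  shape i j h := by
    rw [diff_eq_zero o ε (by simpa using h)]
    rfl
  d_comp_d' i j k hij hjk := by
    obtain rfl : i + 1 = j := hij
    obtain rfl : i + 1 + 1 = k := hjk
    rw [← ModuleCat.ofHom_comp, diff_comp_diff hε]
    rfl

/-- The odd Khovanov homology in homological degree `i`. -/
noncomputable abbrev Okh (o : Fin D.n → Bool) (ε : D.State → Fin D.n → ℤˣ)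
    (hε : D.IsValidSign o ε) (i : ℤ) : ModuleCat ℤ :=
  (D.oddKhovanovComplex o ε hε).homology i

/-! ### Dots -/

/-- The exponent `S(D, α) = (c(D, α) + c(D, 0) + deg α) / 2`, where `c(D, α)` is the number of circles
of `D_α` (the numerator is even). -/
noncomputable def signExponent (α : D.State) : ℕ :=
  (Nat.card (D.Circle α) + Nat.card (D.Circle fun _ => false) + D.deg α) / 2

/-- The map in degree `i` of the identity cobordism of `D` with a dot on the edge `e`: at the vertex
`α` it is `(-1) ^ S(D, α)` times the left multiplication with the circle on which `e` lies. -/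
noncomputable def dot (e : D.Edge) (i : ℤ) : D.Chain i →ₗ[ℤ] D.Chain i :=
  LinearMap.pi fun α =>
    (-1 : ℤˣ) ^ D.signExponent α.1 •
      (LinearMap.mulLeft ℤ (D.gen α.1 e)).comp (LinearMap.proj α)

end LinkDiagram

/-! Left multiplications by circles anticommute and square to zero, hence so do the dots. A dot
commutes with the differential: its circle is carried through a merge, and it passes the factor of a
split with a minus sign, while the exponent S is constant along merges and grows by one along splits
(`saddle_gen_mul`).

It remains to check the relations of the coloring group on homology. Every resolution of a crossing
joins each under edge to an over edge, so the two over dots and the two under dots have the same sum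
already as chain maps (`dot_over_add_dot_over`). Once the two over dots are homotopic, this becomes
the relation with coefficient 2.

The homotopy at a crossing x is the sum of the reversed saddles at x with signs (-1)^S ε
(`diff_back_add_back_diff`). Together with the saddles at x it produces the difference of the over
dots (`cubeStep_cubeBack_self`). Together with a saddle at another crossing it must cancel on every
face of the cube (`IsValidSign.backFactor_anticommute`). Either both mixed composites vanish, or the
product of the four edge signs is needed. That product is forced by the anticommuting face when the
forward composite is not killed by 2, and is prescribed by the type Y convention when the forward
composite vanishes.

For these computations all maps are lifted to the exterior algebra on the edges of the diagram,
where a saddle in either direction is multiplication by 1 or by plus or minus the difference of the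
over edges (`saddle_edgeMap`, `backSaddle_edgeMap`).

Planarity enters only through `isMerge_iff`: a change of resolution merges two circles or splits
one. A checkerboard coloring directs the edges alternately around crossings, so circles become
cycles of a permutation, and changing a resolution multiplies this permutation by a transposition.
-/

namespace Equiv.Perm

/-! ### Cycles of a permutation multiplied by a transposition -/

variable {ι : Type*} [Finite ι] [DecidableEq ι] {σ : Equiv.Perm ι} {a b : ι}

/-- With k the first time at which σ takes a to b, the new permutation sends b to σ a, then runs
along σ² a, ..., σ^k a = b and closes up. This cycle avoids a. -/
lemma SameCycle.not_sameCycle_mul_swap (hab : a ≠ b) (h : σ.SameCycle a b) :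
    ¬ (σ * Equiv.swap a b).SameCycle a b := by
  obtain ⟨i, hi⟩ := h.exists_nat_pow_eq
  have hex : ∃ j : ℕ, (σ ^ j) a = b := ⟨i, hi⟩
  let k := Nat.find hex
  have hk : (σ ^ k) a = b := Nat.find_spec hex
  have hmin : ∀ j < k, (σ ^ j) a ≠ b := fun j hj => Nat.find_min hex hj
  have hret : ∀ j, 1 ≤ j → j ≤ k → (σ ^ j) a ≠ a := by
    intro j hj hjk hja
    rcases hjk.eq_or_lt with rfl | hlt
    · exact hab (hja.symm.trans hk)
    · apply hmin (k - j) (by omega)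
      have : (σ ^ (k - j)) ((σ ^ j) a) = b := by
        rw [← mul_apply, ← pow_add, Nat.sub_add_cancel hjk, hk]
      rwa [hja] at this
  have hk0 : k ≠ 0 := by
    intro h0
    rw [h0] at hk
    exact hab hk
  have hstep : ∀ m : ℕ, ∃ j, 1 ≤ j ∧ j ≤ k ∧ ((σ * Equiv.swap a b) ^ m) b = (σ ^ j) a := by
    intro m
    induction m with
    | zero => exact ⟨k, by omega, le_rfl, hk.symm⟩
    | succ m ih =>
      obtain ⟨j, hj, hjk, hm⟩ := ih
      rw [pow_succ', mul_apply, hm, mul_apply]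
      rcases hjk.eq_or_lt with rfl | hlt
      · exact ⟨1, le_rfl, hj, by rw [hk, Equiv.swap_apply_right, pow_one]⟩
      · refine ⟨j + 1, by omega, hlt, ?_⟩
        rw [Equiv.swap_apply_of_ne_of_ne (hret j hj hjk) (hmin j hlt), pow_succ', mul_apply]
  intro hs
  obtain ⟨m, hm⟩ := hs.symm.exists_nat_pow_eq
  obtain ⟨j, hj, hjk, h'⟩ := hstep m
  exact hret j hj hjk (h'.symm.trans hm)

/-- The new permutation sends b to σ a and then follows the old cycle of a, which does not meet b,
until it arrives at a. -/
lemma sameCycle_mul_swap (h : ¬ σ.SameCycle a b) : (σ * Equiv.swap a b).SameCycle a b := by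
  have hstep : ∀ m : ℕ, (σ * Equiv.swap a b).SameCycle b ((σ ^ (m + 1)) a) := by
    intro m
    induction m with
    | zero => exact ⟨1, by simp⟩
    | succ m ih =>
      by_cases ha : (σ ^ (m + 1)) a = a
      · rw [pow_succ', mul_apply, ha]
        exact ⟨1, by simp⟩
      · have hb : (σ ^ (m + 1)) a ≠ b := fun hb => h ⟨(m + 1 : ℕ), by rwa [zpow_natCast]⟩
        have : (σ ^ (m + 1 + 1)) a = (σ * Equiv.swap a b) ((σ ^ (m + 1)) a) := by
          rw [mul_apply, Equiv.swap_apply_of_ne_of_ne ha hb, pow_succ' _ (m + 1), mul_apply]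
        rw [this]
        exact sameCycle_apply_right.2 ih
  have := hstep (orderOf σ - 1)
  rw [Nat.sub_add_cancel (orderOf_pos σ), pow_orderOf_eq_one] at this
  exact this.symm

/-- Composing a permutation with a transposition merges or splits the cycles of the two
transposed points. -/
lemma sameCycle_swap_mul_iff (hab : a ≠ b) :
    (Equiv.swap a b * σ).SameCycle a b ↔ ¬ σ.SameCycle a b := by
  rw [← sameCycle_inv, mul_inv_rev, Equiv.swap_inv, ← sameCycle_inv (f := σ)]
  exact ⟨fun h h' => h'.not_sameCycle_mul_swap hab h, sameCycle_mul_swap⟩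

end Equiv.Perm

namespace LinkDiagram

variable (D : LinkDiagram)

/-! ### Checkerboard colorings -/

instance : Finite (MapFaces D.opp) := by unfold MapFaces; infer_instance

instance : Finite (MapComponents D.opp) := by unfold MapComponents; infer_instance

/-- The region on the left of a half-edge. -/
def face (h : HalfEdge D.n) : MapFaces D.opp := Quot.mk _ h

lemma face_eq_opp (h : HalfEdge D.n) : D.face h = D.face ((D.opp h).1, (D.opp h).2 - 1) :=
  Quot.sound rfl

lemma fin_four_cases (k : Fin 4) : k = 0 ∨ k = 1 ∨ k = 2 ∨ k = 3 := by
  revert k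
  decide

/-- The cochains modulo `2` on the edges which contain a crossing, as functions of half-edges. -/
def edgeCochains : Submodule (ZMod 2) (HalfEdge D.n → ZMod 2) where
  carrier := {f | ∀ h, f (D.opp h) = f h}
  add_mem' hf hg h := by simp [hf h, hg h]
  zero_mem' h := rfl
  smul_mem' c f hf h := by simp [hf h]

/-- A cochain is determined by its values on the outgoing half-edges of the link orientation, of
which there are two at each crossing: position 2, and position 1 or 3 according to the sign. -/
lemma finrank_edgeCochains_le : Module.finrank (ZMod 2) D.edgeCochains ≤ D.n * 2 := by
  let pos : Fin D.n × Fin 2 → HalfEdge D.n := fun p =>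
    (p.1, if p.2 = 0 then 2 else if D.positive p.1 then 1 else 3)
  have hout : ∀ h, isOutgoing D.positive h = true → ∃ p, pos p = h := by
    rintro ⟨x, k⟩ h
    have h4 := fin_four_cases k
    rcases h4 with rfl | rfl | rfl | rfl
    · simp [isOutgoing] at h
    · exact ⟨(x, 1), by simpa [isOutgoing, pos] using h⟩
    · exact ⟨(x, 0), by simp [pos]⟩
    · exact ⟨(x, 1), by simpa [isOutgoing, pos] using h⟩
  have hinj : Function.Injective
      ((LinearMap.funLeft (ZMod 2) (ZMod 2) pos).comp D.edgeCochains.subtype) := by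
    rw [← LinearMap.ker_eq_bot, LinearMap.ker_eq_bot']
    intro f hf
    have hf' : ∀ h, isOutgoing D.positive h = true → f.1 h = 0 := by
      intro h hh
      obtain ⟨p, rfl⟩ := hout h hh
      exact congrFun hf p
    ext h
    by_cases hh : isOutgoing D.positive h = true
    · exact hf' h hh
    · have := hf' (D.opp h) (by rw [D.oriented]; simpa using hh)
      rwa [f.2 h] at this
  simpa using LinearMap.finrank_le_finrank_of_injective hinj

/-- The coboundary of a cochain on the regions. -/
def faceCoboundary : (MapFaces D.opp → ZMod 2) →ₗ[ZMod 2] D.edgeCochains where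
  toFun f := ⟨fun h => f (D.face h) + f (D.face (h.1, h.2 - 1)), by
    intro h
    have h2 : D.face (D.opp h) = D.face (h.1, h.2 - 1) := by
      rw [D.face_eq_opp, D.opp_opp]
    beta_reduce
    rw [D.face_eq_opp h, h2, add_comm]⟩
  map_add' f g := by
    ext h
    simp only [Pi.add_apply, Submodule.coe_add]
    ring
  map_smul' c f := by
    ext h
    simp [mul_add]

lemma faceCoboundary_apply (f : MapFaces D.opp → ZMod 2) (h : HalfEdge D.n) :
    (D.faceCoboundary f).1 h = f (D.face h) + f (D.face (h.1, h.2 - 1)) := rfl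

/-- The coboundary of a cochain on the edges. -/
def edgeCoboundary : D.edgeCochains →ₗ[ZMod 2] (Fin D.n → ZMod 2) :=
  (LinearMap.pi fun x => ∑ k : Fin 4, LinearMap.proj (x, k)).comp D.edgeCochains.subtype

lemma edgeCoboundary_apply (f : D.edgeCochains) (x : Fin D.n) :
    D.edgeCoboundary f x = f.1 (x, 0) + f.1 (x, 1) + f.1 (x, 2) + f.1 (x, 3) := by
  simp [edgeCoboundary, Fin.sum_univ_four]

lemma edgeCoboundary_faceCoboundary (f : MapFaces D.opp → ZMod 2) :
    D.edgeCoboundary (D.faceCoboundary f) = 0 := by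
  ext x
  have h2 : ∀ a : ZMod 2, a + a = 0 := by decide
  simp only [edgeCoboundary_apply, faceCoboundary_apply]
  have e0 : (0 : Fin 4) - 1 = 3 := rfl
  have e1 : (1 : Fin 4) - 1 = 0 := rfl
  have e2 : (2 : Fin 4) - 1 = 1 := rfl
  have e3 : (3 : Fin 4) - 1 = 2 := rfl
  simp only [e0, e1, e2, e3, Pi.zero_apply]
  have : ∀ a b c d : ZMod 2, a + d + (b + a) + (c + b) + (d + c) = 0 := by decide
  apply this

/-- A cocycle is constant on the corners around a crossing and, through shared regions, along edges;
so one value for each component determines it. -/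
lemma finrank_ker_faceCoboundary_le :
    Module.finrank (ZMod 2) (LinearMap.ker D.faceCoboundary) ≤ Nat.card (MapComponents D.opp) := by
  have := Fintype.ofFinite (MapComponents D.opp)
  let rep : MapComponents D.opp → MapFaces D.opp := fun c => D.face (Quot.out c, 0)
  have hinj : Function.Injective ((LinearMap.funLeft (ZMod 2) (ZMod 2) rep).comp
      (LinearMap.ker D.faceCoboundary).subtype) := by
    rw [← LinearMap.ker_eq_bot, LinearMap.ker_eq_bot']
    rintro ⟨f, hf⟩ hf0
    have hz : ∀ a b : ZMod 2, a + b = 0 → a = b := by decide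
    have hpos : ∀ x k, f (D.face (x, k)) = f (D.face (x, k - 1)) := by
      intro x k
      have := congrArg (fun g : D.edgeCochains => g.1 (x, k)) hf
      exact hz _ _ this
    have hvert : ∀ x k, f (D.face (x, k)) = f (D.face (x, 0)) := by
      intro x k
      have h1 : f (D.face (x, 1)) = f (D.face (x, 0)) := hpos x 1
      have h2 : f (D.face (x, 2)) = f (D.face (x, 1)) := hpos x 2
      have h3 : f (D.face (x, 3)) = f (D.face (x, 2)) := hpos x 3
      have h4 := fin_four_cases k
      rcases h4 with rfl | rfl | rfl | rfl
      · rfl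
      · exact h1
      · exact h2.trans h1
      · exact h3.trans (h2.trans h1)
    let g : MapComponents D.opp → ZMod 2 := Quot.lift (fun x => f (D.face (x, 0))) (by
      rintro _ _ ⟨h, rfl, rfl⟩
      rw [← hvert h.1 h.2, ← hvert (D.opp h).1 ((D.opp h).2 - 1), ← D.face_eq_opp])
    have hg : ∀ c, g c = 0 := by
      intro c
      rw [← Quot.out_eq c]
      exact congrFun hf0 c
    ext c
    obtain ⟨⟨x, k⟩, rfl⟩ := Quot.exists_rep c
    exact (hvert x k).trans (hg (Quot.mk _ x))
  simpa [Nat.card_eq_fintype_card] using LinearMap.finrank_le_finrank_of_injective hinj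

/-- The coboundary of a single edge identifies the classes of its two ends in the cokernel, so the
cokernel is generated by one class for each component. -/
lemma finrank_range_edgeCoboundary_ge :
    D.n ≤ Module.finrank (ZMod 2) (LinearMap.range D.edgeCoboundary) +
      Nat.card (MapComponents D.opp) := by
  classical
  have := Fintype.ofFinite (MapComponents D.opp)
  let R := LinearMap.range D.edgeCoboundary
  have hadj : ∀ h : HalfEdge D.n, (Pi.single h.1 1 - Pi.single (D.opp h).1 1 : Fin D.n → ZMod 2) ∈ R := by
    intro h
    have hmem : (Pi.single h 1 + Pi.single (D.opp h) 1 : HalfEdge D.n → ZMod 2) ∈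
        D.edgeCochains := by
      intro h'
      simp only [Pi.add_apply, Pi.single_apply]
      have e1 : D.opp h' = h ↔ h' = D.opp h :=
        ⟨fun e => by rw [← e, D.opp_opp], fun e => by rw [e, D.opp_opp]⟩
      have e2 : D.opp h' = D.opp h ↔ h' = h :=
        ⟨fun e => by rw [← D.opp_opp h', e, D.opp_opp], fun e => by rw [e]⟩
      simp only [e1, e2, add_comm]
    refine ⟨⟨_, hmem⟩, ?_⟩
    have hs : ∀ (g : HalfEdge D.n) (x : Fin D.n),
        ∑ k : Fin 4, (Pi.single g 1 : HalfEdge D.n → ZMod 2) (x, k) =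
          (Pi.single g.1 1 : Fin D.n → ZMod 2) x := by
      rintro ⟨y, l⟩ x
      simp only [Pi.single_apply, Prod.mk.injEq]
      by_cases hxy : x = y <;> simp [hxy]
    ext x
    have hx : D.edgeCoboundary ⟨_, hmem⟩ x =
        ∑ k : Fin 4, ((Pi.single h 1 : HalfEdge D.n → ZMod 2) (x, k) +
          (Pi.single (D.opp h) 1 : HalfEdge D.n → ZMod 2) (x, k)) := by
      simp [edgeCoboundary]
    rw [hx, Finset.sum_add_distrib, hs, hs, Pi.sub_apply]
    generalize (Pi.single h.1 1 : Fin D.n → ZMod 2) x = a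
    generalize (Pi.single (D.opp h).1 1 : Fin D.n → ZMod 2) x = b
    revert a b
    decide
  let ψ : MapComponents D.opp → (Fin D.n → ZMod 2) ⧸ R :=
    Quot.lift (fun x => Submodule.Quotient.mk (Pi.single x 1)) (by
      rintro _ _ ⟨h, rfl, rfl⟩
      exact (Submodule.Quotient.eq R).2 (hadj h))
  have hspan : Submodule.span (ZMod 2) (Set.range ψ) = ⊤ := by
    rw [eq_top_iff]
    rintro v -
    obtain ⟨v, rfl⟩ := Submodule.Quotient.mk_surjective R v
    rw [pi_eq_sum_univ' v, ← Submodule.mkQ_apply, map_sum]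
    refine Submodule.sum_mem _ fun x _ => ?_
    rw [map_smul]
    refine Submodule.smul_mem _ _ (Submodule.subset_span ⟨Quot.mk _ x, ?_⟩)
    simp only [ψ, Submodule.mkQ_apply]
  have hle : Module.finrank (ZMod 2) ((Fin D.n → ZMod 2) ⧸ R) ≤ Nat.card (MapComponents D.opp) := by
    rw [← finrank_top, ← hspan, Nat.card_eq_fintype_card]
    exact finrank_range_le_card ψ
  have := Submodule.finrank_quotient_add_finrank R
  simp only [Module.finrank_fintype_fun_eq_card, Fintype.card_fin] at this
  change D.n ≤ Module.finrank (ZMod 2) R + _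
  omega

/-- The regions of a link diagram can be colored with two colors in such a way that the colors on
the two sides of each edge are different. -/
lemma exists_checkerboard : ∃ f : MapFaces D.opp → ZMod 2,
    ∀ h : HalfEdge D.n, f (D.face h) + f (D.face (h.1, h.2 - 1)) = 1 := by
  have := Fintype.ofFinite (MapFaces D.opp)
  have h1 := LinearMap.finrank_range_add_finrank_ker D.faceCoboundary
  have h2 := LinearMap.finrank_range_add_finrank_ker D.edgeCoboundary
  have h3 := D.finrank_edgeCochains_le
  have h4 := D.finrank_ker_faceCoboundary_le
  have h5 := D.finrank_range_edgeCoboundary_ge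
  have h6 := D.planar
  rw [Module.finrank_fintype_fun_eq_card, ← Nat.card_eq_fintype_card, h6] at h1
  have hle : LinearMap.range D.faceCoboundary ≤ LinearMap.ker D.edgeCoboundary := by
    rintro _ ⟨f, rfl⟩
    exact D.edgeCoboundary_faceCoboundary f
  -- With C components there are n + 2C regions, so the image has dimension at least n + C, and the
  -- kernel has dimension at most 2n - (n - C) = n + C. This is the vanishing of the first
  -- cohomology modulo 2 of a union of spheres.
  have heq := Submodule.eq_of_le_of_finrank_le hle (by omega)
  -- The constant cochain 1 is closed because each crossing has four half-edges; a cochain on the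
  -- regions that bounds it is a checkerboard coloring.
  have hmem : (⟨fun _ => 1, fun _ => rfl⟩ : D.edgeCochains) ∈ LinearMap.ker D.edgeCoboundary := by
    rw [LinearMap.mem_ker]
    ext x
    rw [edgeCoboundary_apply]
    change (1 + 1 + 1 + 1 : ZMod 2) = 0
    decide
  rw [← heq] at hmem
  obtain ⟨f, hf⟩ := hmem
  exact ⟨f, fun h => congrArg (fun g : D.edgeCochains => g.1 h) hf⟩

/-- The edges of a link diagram can be directed in such a way that the directions alternate
around each crossing. -/
lemma exists_alternating : ∃ dir : HalfEdge D.n → Bool,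
    (∀ h, dir (D.opp h) = !dir h) ∧ ∀ x k, dir (x, k) = !dir (x, k - 1) := by
  obtain ⟨f, hf⟩ := D.exists_checkerboard
  have key : ∀ a b : ZMod 2, a + b = 1 → decide (a = 1) = !decide (b = 1) := by decide
  -- Each edge is directed so that the region of color 1 lies on its left.
  refine ⟨fun h => decide (f (D.face h) = 1), fun h => ?_, fun x k => key _ _ (hf (x, k))⟩
  simp only [D.face_eq_opp h]
  exact key _ _ (hf (D.opp h))

end LinkDiagram

namespace LinkDiagram

variable {D : LinkDiagram}

/-! ### Circles as cycles of a permutation -/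

/-- The position which is joined to a given one in a resolution of a crossing. -/
def turn (b : Bool) (k : Fin 4) : Fin 4 := if b then 3 - k else 3 - (k + 2)

lemma turn_turn (b : Bool) (k : Fin 4) : turn b (turn b k) = k := by
  revert b k
  decide

lemma circle_turn (α : D.State) (x : Fin D.n) (k : Fin 4) :
    D.circle α (D.edge x k) = D.circle α (D.edge x (turn (α x) k)) := by
  cases hx : α x
  · have h1 : D.circle α (D.edge x 0) = D.circle α (D.edge x 1) :=
      Quot.sound ⟨x, Or.inl ⟨hx, Or.inl ⟨rfl, rfl⟩⟩⟩
    have h2 : D.circle α (D.edge x 2) = D.circle α (D.edge x 3) :=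
      Quot.sound ⟨x, Or.inl ⟨hx, Or.inr ⟨rfl, rfl⟩⟩⟩
    rcases fin_four_cases k with rfl | rfl | rfl | rfl
    exacts [h1, h1.symm, h2, h2.symm]
  · have h1 : D.circle α (D.edge x 0) = D.circle α (D.edge x 3) :=
      Quot.sound ⟨x, Or.inr ⟨hx, Or.inl ⟨rfl, rfl⟩⟩⟩
    have h2 : D.circle α (D.edge x 1) = D.circle α (D.edge x 2) :=
      Quot.sound ⟨x, Or.inr ⟨hx, Or.inr ⟨rfl, rfl⟩⟩⟩
    rcases fin_four_cases k with rfl | rfl | rfl | rfl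
    exacts [h1, h2, h2.symm, h1.symm]

lemma Joined.exists_turn {α : D.State} {e e' : D.Edge} (h : D.Joined α e e') :
    ∃ x k, e = D.edge x k ∧ e' = D.edge x (turn (α x) k) := by
  obtain ⟨x, ⟨hx, ⟨rfl, rfl⟩ | ⟨rfl, rfl⟩⟩ | ⟨hx, ⟨rfl, rfl⟩ | ⟨rfl, rfl⟩⟩⟩ := h
  · exact ⟨x, 0, rfl, by rw [hx]; rfl⟩
  · exact ⟨x, 2, rfl, by rw [hx]; rfl⟩
  · exact ⟨x, 0, rfl, by rw [hx]; rfl⟩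
  · exact ⟨x, 1, rfl, by rw [hx]; rfl⟩

lemma edge_opp (h : HalfEdge D.n) : D.edge (D.opp h).1 (D.opp h).2 = D.edge h.1 h.2 :=
  congrArg Sum.inl (Quot.sound (D.opp_opp h).symm)

variable {dir : HalfEdge D.n → Bool}

/-- Both resolutions join positions of opposite parity, so alternating directions fit together along
every circle of every resolution. -/
lemma alternating_turn (h2 : ∀ x k, dir (x, k) = !dir (x, k - 1)) (b : Bool) (x : Fin D.n)
    (k : Fin 4) : dir (x, turn b k) = !dir (x, k) := by
  have e1 : dir (x, 1) = !dir (x, 0) := h2 x 1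
  have e2 : dir (x, 2) = !dir (x, 1) := h2 x 2
  have e3 : dir (x, 3) = !dir (x, 2) := h2 x 3
  rcases fin_four_cases k with rfl | rfl | rfl | rfl <;> cases b <;>
    simp [turn, e1, e2, e3]

variable (h1 : ∀ h, dir (D.opp h) = !dir h) (h2 : ∀ x k, dir (x, k) = !dir (x, k - 1))

/-- The permutation of the directed edges which follows the circles of a resolved diagram. -/
def follow (α : D.State) : Equiv.Perm {h // dir h = true} where
  toFun h := ⟨((D.opp h).1, turn (α (D.opp h).1) (D.opp h).2), by
    rw [alternating_turn h2, Prod.mk.eta, h1, h.2]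
    rfl⟩
  invFun h := ⟨D.opp (h.1.1, turn (α h.1.1) h.1.2), by
    rw [h1, alternating_turn h2, Prod.mk.eta, h.2]
    rfl⟩
  left_inv h := by simp [turn_turn, D.opp_opp]
  right_inv h := by simp [turn_turn, D.opp_opp]

/-- The direction of the edge of a half-edge. -/
def directed (h : HalfEdge D.n) : {h // dir h = true} :=
  if hd : dir h = true then ⟨h, hd⟩ else ⟨D.opp h, by rw [h1]; simpa using hd⟩

lemma directed_of_true {h : HalfEdge D.n} (hd : dir h = true) : directed h1 h = ⟨h, hd⟩ :=
  dif_pos hd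

lemma directed_opp (h : HalfEdge D.n) : directed h1 (D.opp h) = directed h1 h := by
  unfold directed
  by_cases hd : dir h = true
  · have : ¬ dir (D.opp h) = true := by simp [h1, hd]
    rw [dif_neg this, dif_pos hd]
    simp [D.opp_opp]
  · have : dir (D.opp h) = true := by simpa [h1] using hd
    rw [dif_pos this, dif_neg hd]

lemma circle_follow (α : D.State) (h : {h // dir h = true}) :
    D.circle α (D.edge (follow h1 h2 α h).1.1 (follow h1 h2 α h).1.2) =
      D.circle α (D.edge h.1.1 h.1.2) := by
  rw [← edge_opp h.1, circle_turn α (D.opp h).1]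
  rfl

lemma circle_eq_of_sameCycle (α : D.State) {h h' : {h // dir h = true}}
    (hs : (follow h1 h2 α).SameCycle h h') :
    D.circle α (D.edge h.1.1 h.1.2) = D.circle α (D.edge h'.1.1 h'.1.2) := by
  obtain ⟨m, rfl⟩ := hs.exists_nat_pow_eq
  clear hs
  induction m with
  | zero => rfl
  | succ m ih => rw [pow_succ', Equiv.Perm.mul_apply, circle_follow, ih]

lemma sameCycle_turn (α : D.State) (x : Fin D.n) (k : Fin 4) :
    (follow h1 h2 α).SameCycle (directed h1 (x, k)) (directed h1 (x, turn (α x) k)) := by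
  have key : ∀ k, dir (x, turn (α x) k) = true →
      (follow h1 h2 α).SameCycle (directed h1 (x, k)) (directed h1 (x, turn (α x) k)) := by
    intro k hd
    have hd' : dir (D.opp (x, k)) = true := by
      rw [h1, ← alternating_turn h2 (α x), hd]
    refine ⟨1, ?_⟩
    rw [← directed_opp, directed_of_true h1 hd', directed_of_true h1 hd]
    ext : 1
    simp [follow, D.opp_opp]
  by_cases hd : dir (x, turn (α x) k) = true
  · exact key k hd
  · have := key (turn (α x) k) (by
      rw [turn_turn]
      rw [alternating_turn h2] at hd
      simpa using hd)
    rw [turn_turn] at this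
    exact this.symm

/-- The cycle of an edge is unchanged along the arcs of the resolution, so it is a function on
circles. Circles without crossings have no half-edges and get the value `none`. -/
lemma sameCycle_of_circle_eq (α : D.State) {h h' : HalfEdge D.n}
    (hc : D.circle α (D.edge h.1 h.2) = D.circle α (D.edge h'.1 h'.2)) :
    (follow h1 h2 α).SameCycle (directed h1 h) (directed h1 h') := by
  let S := Equiv.Perm.SameCycle.setoid (follow h1 h2 α)
  let g : D.Edge → Option (Quotient S) :=
    Sum.elim (Quot.lift (fun h => some (Quotient.mk S (directed h1 h))) (by
      rintro a _ rfl
      simp only [directed_opp])) fun _ => none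
  let g' : D.Circle α → Option (Quotient S) := Quot.lift g (by
    rintro _ _ hj
    obtain ⟨x, k, rfl, rfl⟩ := hj.exists_turn
    exact congrArg some (Quotient.sound (sameCycle_turn h1 h2 α x k)))
  exact Quotient.exact (Option.some.inj (congrArg g' hc))

/-- Of the four half-edges at x, two are outgoing. Both resolutions send the two incoming ends
bijectively to these, in opposite ways. -/
lemma follow_flip [DecidableEq {h // dir h = true}] (α : D.State) (x : Fin D.n) (hx : α x = false)
    {a b : Fin 4} (ha : dir (x, a) = true) (hb : dir (x, b) = true) (hab : a ≠ b) :
    follow h1 h2 (D.flip α x) =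
      Equiv.swap (⟨(x, a), ha⟩ : {h // dir h = true}) ⟨(x, b), hb⟩ * follow h1 h2 α := by
  have ht : ∀ k, dir (x, k) = false →
      (turn false k = a ∧ turn true k = b) ∨ (turn false k = b ∧ turn true k = a) := by
    intro k hk
    have hd : ∀ k, dir (x, k) = (dir (x, 0) ^^ decide (k = 1 ∨ k = 3)) := by
      have e1 : dir (x, 1) = !dir (x, 0) := h2 x 1
      have e2 : dir (x, 2) = !dir (x, 1) := h2 x 2
      have e3 : dir (x, 3) = !dir (x, 2) := h2 x 3
      intro k
      rcases fin_four_cases k with rfl | rfl | rfl | rfl <;> simp [e1, e2, e3]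
    rw [hd] at ha hb hk
    generalize dir (x, 0) = d at ha hb hk
    clear hd
    revert d a b k
    decide
  ext h : 1
  rw [Equiv.Perm.mul_apply]
  by_cases hh : (D.opp h).1 = x
  · have hd : dir (x, (D.opp h).2) = false := by
      rw [← hh, Prod.mk.eta, h1, h.2]
      rfl
    have f1 : follow h1 h2 α h = ⟨(x, turn false (D.opp h).2), by
        rw [alternating_turn h2, hd]; rfl⟩ := by
      ext : 1
      simp [follow, hh, hx]
    have f2 : follow h1 h2 (D.flip α x) h = ⟨(x, turn true (D.opp h).2), by
        rw [alternating_turn h2, hd]; rfl⟩ := by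
      ext : 1
      simp [follow, hh, flip]
    rw [f1, f2]
    rcases ht _ hd with ⟨e1, e2⟩ | ⟨e1, e2⟩
    · simp only [e1, e2, Equiv.swap_apply_left]
    · simp only [e1, e2, Equiv.swap_apply_right]
  · have f2 : follow h1 h2 (D.flip α x) h = follow h1 h2 α h := by
      ext : 1
      simp [follow, flip, hh]
    rw [f2, Equiv.swap_apply_of_ne_of_ne]
    · exact fun e => hh (congrArg (fun h => h.1.1) e)
    · exact fun e => hh (congrArg (fun h => h.1.1) e)

/-- Changing a resolution merges two circles or splits a circle into two. -/
theorem isMerge_iff (α : D.State) (x : Fin D.n) (hx : α x = false) :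
    D.IsMerge α x ↔
      D.circle (D.flip α x) (D.edge x 1) = D.circle (D.flip α x) (D.edge x 3) := by
  classical
  obtain ⟨dir, h1, h2⟩ := D.exists_alternating
  have hβ : D.flip α x x = true := by simp [flip]
  have key : ∀ a b (ha : dir (x, a) = true) (hb : dir (x, b) = true), a ≠ b →
      (D.circle (D.flip α x) (D.edge x a) = D.circle (D.flip α x) (D.edge x b) ↔
        ¬ D.circle α (D.edge x a) = D.circle α (D.edge x b)) := by
    intro a b ha hb hab
    have iff : ∀ γ, D.circle γ (D.edge x a) = D.circle γ (D.edge x b) ↔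
        (follow h1 h2 γ).SameCycle ⟨(x, a), ha⟩ ⟨(x, b), hb⟩ := by
      intro γ
      refine ⟨fun h => ?_, fun h => circle_eq_of_sameCycle h1 h2 γ h⟩
      have := sameCycle_of_circle_eq h1 h2 γ (h := (x, a)) (h' := (x, b)) h
      rwa [directed_of_true h1 ha, directed_of_true h1 hb] at this
    rw [iff, iff, follow_flip h1 h2 α x hx ha hb hab]
    exact Equiv.Perm.sameCycle_swap_mul_iff fun h => hab (congrArg (fun h => h.1.2) h)
  have c01 := circle_turn α x 0
  have c23 := circle_turn α x 2
  have d03 := circle_turn (D.flip α x) x 0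
  have d12 := circle_turn (D.flip α x) x 1
  rw [hx] at c01 c23
  rw [hβ] at d03 d12
  change _ = D.circle α (D.edge x 1) at c01
  change _ = D.circle α (D.edge x 3) at c23
  change _ = D.circle _ (D.edge x 3) at d03
  change _ = D.circle _ (D.edge x 2) at d12
  have e1 : dir (x, 1) = !dir (x, 0) := h2 x 1
  have e2 : dir (x, 2) = !dir (x, 1) := h2 x 2
  have e3 : dir (x, 3) = !dir (x, 2) := h2 x 3
  unfold IsMerge
  -- The outgoing half-edges are at 1, 3 or at 0, 2. In the second case the arcs 03 and 12 of the
  -- new resolution carry the statement about 1, 3 to one about 0, 2.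
  cases h0 : dir (x, 0)
  · rw [c01, c23]
    exact (key 1 3 (by simp [e1, h0]) (by simp [e3, e2, e1, h0]) (by decide)).symm
  · rw [← d03, d12, eq_comm (b := D.circle (D.flip α x) (D.edge x 0))]
    exact (key 0 2 h0 (by simp [e2, e1, h0]) (by decide)).symm

end LinkDiagram

namespace LinkDiagram

variable {D : LinkDiagram}

/-! ### Circles before and after a surgery -/

instance : Finite D.Edge := by unfold Edge; infer_instance

instance (α : D.State) : Finite (D.Circle α) := by unfold Circle; infer_instance

lemma flip_apply_self (α : D.State) (x : Fin D.n) : D.flip α x x = true := by simp [flip]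

lemma flip_apply_of_ne (α : D.State) {x y : Fin D.n} (h : y ≠ x) : D.flip α x y = α y := by
  simp [flip, h]

/-- In either resolution the positions 1 and 3 lie on different arcs, and these two arcs contain all
four positions. -/
lemma circle_edge_eq_or (o : Fin D.n → Bool) (α : D.State) (x : Fin D.n) (k : Fin 4) :
    D.circle α (D.edge x k) = D.circle α (D.rotTailEdge o x) ∨
      D.circle α (D.edge x k) = D.circle α (D.rotHeadEdge o x) := by
  have key : D.circle α (D.edge x k) = D.circle α (D.edge x 1) ∨
      D.circle α (D.edge x k) = D.circle α (D.edge x 3) := by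
    rcases fin_four_cases k with rfl | rfl | rfl | rfl
    · rw [circle_turn α x 0]
      cases α x
      · exact Or.inl rfl
      · exact Or.inr rfl
    · exact Or.inl rfl
    · rw [circle_turn α x 2]
      cases α x
      · exact Or.inr rfl
      · exact Or.inl rfl
    · exact Or.inr rfl
  unfold rotTailEdge rotHeadEdge
  cases o x
  · exact key.symm
  · exact key

/-- Edges on the same circle stay on the same circle after a surgery, unless this circle is split
between them. -/
lemma circle_eq_or (o : Fin D.n → Bool) {α β : D.State} {x : Fin D.n} (h : ∀ y, y ≠ x → α y = β y)
    {e e' : D.Edge} (he : D.circle α e = D.circle α e') :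
    D.circle β e = D.circle β e' ∨
      (D.circle β e = D.circle β (D.rotTailEdge o x) ∧
        D.circle β e' = D.circle β (D.rotHeadEdge o x)) ∨
      (D.circle β e = D.circle β (D.rotHeadEdge o x) ∧
        D.circle β e' = D.circle β (D.rotTailEdge o x)) := by
  classical
  -- After `r` glues the two circles at x together, the resolution of x no longer matters, so the
  -- glued circle of an edge is a function of its circle in `α`.
  let r : D.Circle β → D.Circle β := fun c =>
    if c = D.circle β (D.rotHeadEdge o x) then D.circle β (D.rotTailEdge o x) else c
  have hr : ∀ k, r (D.circle β (D.edge x k)) = D.circle β (D.rotTailEdge o x) := by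
    intro k
    simp only [r]
    split_ifs with hk
    · rfl
    · exact (circle_edge_eq_or o β x k).resolve_right hk
  let g : D.Circle α → D.Circle β := Quot.lift (fun e => r (D.circle β e)) (by
    intro e e' hj
    obtain ⟨y, k, rfl, rfl⟩ := hj.exists_turn
    by_cases hy : y = x
    · subst hy
      simp only [hr]
    · simp only [h y hy, ← circle_turn])
  have hg : r (D.circle β e) = r (D.circle β e') := congrArg g he
  simp only [r] at hg
  split_ifs at hg with h1 h2 h2
  · exact Or.inl (h1.trans h2.symm)
  · exact Or.inr (Or.inr ⟨h1, hg.symm⟩)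
  · exact Or.inr (Or.inl ⟨hg, h2⟩)
  · exact Or.inl hg

lemma circle_eq_of_rot_eq (o : Fin D.n → Bool) {α β : D.State} {x : Fin D.n}
    (h : ∀ y, y ≠ x → α y = β y)
    (hβ : D.circle β (D.rotTailEdge o x) = D.circle β (D.rotHeadEdge o x))
    {e e' : D.Edge} (he : D.circle α e = D.circle α e') : D.circle β e = D.circle β e' := by
  rcases circle_eq_or o h he with h | ⟨h1, h2⟩ | ⟨h1, h2⟩
  · exact h
  · rw [h1, h2, hβ]
  · rw [h1, h2, hβ]

lemma isMerge_iff_rot_ne (o : Fin D.n → Bool) (α : D.State) (x : Fin D.n) (hx : α x = false) :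
    D.IsMerge α x ↔ D.circle α (D.rotTailEdge o x) ≠ D.circle α (D.rotHeadEdge o x) := by
  have c01 := circle_turn α x 0
  have c23 := circle_turn α x 2
  rw [hx] at c01 c23
  change _ = D.circle α (D.edge x 1) at c01
  change _ = D.circle α (D.edge x 3) at c23
  unfold IsMerge rotTailEdge rotHeadEdge
  rw [c01, c23]
  cases o x
  · exact ne_comm
  · exact Iff.rfl

lemma isMerge_iff_rot_eq (o : Fin D.n → Bool) (α : D.State) (x : Fin D.n) (hx : α x = false) :
    D.IsMerge α x ↔ D.circle (D.flip α x) (D.rotTailEdge o x) =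
      D.circle (D.flip α x) (D.rotHeadEdge o x) := by
  rw [isMerge_iff α x hx]
  unfold rotTailEdge rotHeadEdge
  cases o x
  · exact eq_comm
  · exact Iff.rfl

/-- The induced map of circles identifies exactly the two circles at x, hence is bijective once one
of them is removed. -/
lemma card_circle_eq (o : Fin D.n → Bool) {α β : D.State} {x : Fin D.n}
    (h : ∀ y, y ≠ x → α y = β y)
    (hα : D.circle α (D.rotTailEdge o x) ≠ D.circle α (D.rotHeadEdge o x))
    (hβ : D.circle β (D.rotTailEdge o x) = D.circle β (D.rotHeadEdge o x)) :
    Nat.card (D.Circle α) = Nat.card (D.Circle β) + 1 := by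
  classical
  have := Fintype.ofFinite (D.Circle α)
  have := Fintype.ofFinite (D.Circle β)
  let q : D.Circle α → D.Circle β := Quot.lift (D.circle β) fun e e' hj =>
    circle_eq_of_rot_eq o h hβ (Quot.sound hj)
  have hq : ∀ e, q (D.circle α e) = D.circle β e := fun e => rfl
  let f : {c : D.Circle α // c ≠ D.circle α (D.rotHeadEdge o x)} → D.Circle β := fun c => q c.1
  have hf : Function.Bijective f := by
    constructor
    · rintro ⟨⟨e⟩, he⟩ ⟨⟨e'⟩, he'⟩ hee
      rcases circle_eq_or o (fun y hy => (h y hy).symm) (hee : D.circle β e = D.circle β e')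
        with h | ⟨h1, h2⟩ | ⟨h1, h2⟩
      · exact Subtype.ext h
      · exact absurd h2 he'
      · exact absurd h1 he
    · rintro ⟨e⟩
      by_cases he : D.circle α e = D.circle α (D.rotHeadEdge o x)
      · refine ⟨⟨D.circle α (D.rotTailEdge o x), hα⟩, ?_⟩
        have := circle_eq_of_rot_eq o h hβ he
        exact hβ.trans this.symm
      · exact ⟨⟨D.circle α e, he⟩, rfl⟩
  rw [← Nat.card_congr (Equiv.ofBijective f hf), Nat.card_eq_fintype_card, Nat.card_eq_fintype_card,
    Fintype.card_subtype_compl, Fintype.card_subtype_eq]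
  have : 0 < Fintype.card (D.Circle α) := Fintype.card_pos_iff.2 ⟨D.circle α (D.rotHeadEdge o x)⟩
  omega

lemma card_circle_of_isMerge {α : D.State} {x : Fin D.n} (hx : α x = false) (h : D.IsMerge α x) :
    Nat.card (D.Circle α) = Nat.card (D.Circle (D.flip α x)) + 1 :=
  card_circle_eq (fun _ => false) (fun _ hy => (flip_apply_of_ne α hy).symm)
    ((isMerge_iff_rot_ne _ α x hx).1 h) ((isMerge_iff_rot_eq _ α x hx).1 h)

lemma card_circle_of_not_isMerge {α : D.State} {x : Fin D.n} (hx : α x = false)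
    (h : ¬ D.IsMerge α x) :
    Nat.card (D.Circle (D.flip α x)) = Nat.card (D.Circle α) + 1 :=
  card_circle_eq (fun _ => false) (fun _ hy => flip_apply_of_ne α hy)
    (fun h' => h ((isMerge_iff_rot_eq _ α x hx).2 h'))
    (not_not.1 fun h' => h ((isMerge_iff_rot_ne _ α x hx).2 h'))

/-- A merge loses a circle and gains a one, leaving the numerator of S unchanged. A split raises it
by 2, so evenness of the numerator is not needed. -/
lemma signExponent_of_isMerge {α : D.State} {x : Fin D.n} (hx : α x = false) (h : D.IsMerge α x) :
    D.signExponent (D.flip α x) = D.signExponent α := by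
  unfold signExponent
  rw [card_circle_of_isMerge hx h, deg_flip α x hx]
  congr 1
  ring

lemma signExponent_of_not_isMerge {α : D.State} {x : Fin D.n} (hx : α x = false)
    (h : ¬ D.IsMerge α x) : D.signExponent (D.flip α x) = D.signExponent α + 1 := by
  unfold signExponent
  rw [card_circle_of_not_isMerge hx h, deg_flip α x hx]
  omega

/-! ### Saddles in terms of edges -/

variable (D) in
/-- The exterior algebra of the free abelian group on the edges. -/
abbrev EdgeAlg : Type := ExteriorAlgebra ℤ (D.Edge →₀ ℤ)

/-- The map to the exterior algebra of a resolution which sends each edge to its circle. -/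
noncomputable def edgeMap (α : D.State) : D.EdgeAlg →ₐ[ℤ] D.Lam α :=
  ExteriorAlgebra.map (Finsupp.lmapDomain ℤ ℤ (D.circle α))

variable (D) in
/-- An edge as an element of the exterior algebra. -/
noncomputable def edgeGen (e : D.Edge) : D.EdgeAlg := ExteriorAlgebra.ι ℤ (Finsupp.single e 1)

variable (D) in
/-- The difference of the edges at the ends of the turned arrow at a crossing. -/
noncomputable def chord (o : Fin D.n → Bool) (x : Fin D.n) : D.EdgeAlg :=
  D.edgeGen (D.rotTailEdge o x) - D.edgeGen (D.rotHeadEdge o x)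

@[simp] lemma edgeMap_edgeGen (α : D.State) (e : D.Edge) :
    edgeMap α (D.edgeGen e) = D.gen α e := by
  simp [edgeMap, edgeGen, gen]

lemma edgeMap_chord (o : Fin D.n → Bool) (α : D.State) (x : Fin D.n) :
    edgeMap α (D.chord o x) =
      D.gen α (D.rotTailEdge o x) - D.gen α (D.rotHeadEdge o x) := by
  simp [chord]

lemma edgeMap_surjective (α : D.State) : Function.Surjective (edgeMap α) := by
  unfold edgeMap
  rw [ExteriorAlgebra.map_surjective_iff]
  exact Finsupp.mapDomain_surjective Quot.mk_surjective

lemma gen_congr {α : D.State} {e e' : D.Edge} (h : D.circle α e = D.circle α e') :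
    D.gen α e = D.gen α e' := by
  rw [gen, gen, h]

lemma gen_mul_self (α : D.State) (e : D.Edge) : D.gen α e * D.gen α e = 0 :=
  ExteriorAlgebra.ι_sq_zero _

lemma gen_mul_gen (α : D.State) (e e' : D.Edge) : D.gen α e * D.gen α e' = -(D.gen α e' * D.gen α e) :=
  eq_neg_of_add_eq_zero_left (ExteriorAlgebra.ι_add_mul_swap _ _)

/-- When the circles of `β` are coarser than those of `α`, the representative edge chosen by
`transport` is immaterial. -/
lemma transportMap_edgeMap {α β : D.State}
    (h : ∀ e e', D.circle α e = D.circle α e' → D.circle β e = D.circle β e') (w : D.EdgeAlg) :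
    D.transportMap α β (edgeMap α w) = edgeMap β w := by
  have ht : D.transport α β ∘ D.circle α = D.circle β := by
    funext e
    exact h _ _ (Quot.out_eq (D.circle α e))
  have : (ExteriorAlgebra.map (Finsupp.lmapDomain ℤ ℤ (D.transport α β))).comp (edgeMap α) =
      edgeMap β := by
    rw [edgeMap, edgeMap, ExteriorAlgebra.map_comp_map, ← Finsupp.lmapDomain_comp, ht]
  exact DFunLike.congr_fun this w

/-- For a split, a wrong choice in `transport` changes a generator by plus or minus δ, and this is
killed by the factor δ. In a longer product, δ is first moved past the preceding factors at the cost
of signs. -/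
lemma mul_transportMap_edgeMap {α β : D.State} {a b : D.Edge}
    (h : ∀ e e', D.circle α e = D.circle α e' → D.circle β e = D.circle β e' ∨
      (D.circle β e = D.circle β a ∧ D.circle β e' = D.circle β b) ∨
      (D.circle β e = D.circle β b ∧ D.circle β e' = D.circle β a)) (w : D.EdgeAlg) :
    (D.gen β a - D.gen β b) * D.transportMap α β (edgeMap α w) =
      (D.gen β a - D.gen β b) * edgeMap β w := by
  set δ := D.gen β a - D.gen β b with hδ
  let φ := (ExteriorAlgebra.map (Finsupp.lmapDomain ℤ ℤ (D.transport α β))).comp (edgeMap α)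
  have hφ : ∀ w, D.transportMap α β (edgeMap α w) = φ w := fun w => rfl
  have hδ' : δ = ExteriorAlgebra.ι ℤ
      (Finsupp.single (D.circle β a) 1 - Finsupp.single (D.circle β b) 1) := by
    rw [map_sub]
    rfl
  have hsq : δ * δ = 0 := by
    rw [hδ']
    exact ExteriorAlgebra.ι_sq_zero _
  have hφι : ∀ v, φ (ExteriorAlgebra.ι ℤ v) = ExteriorAlgebra.ι ℤ
      (Finsupp.lmapDomain ℤ ℤ (D.transport α β) (Finsupp.lmapDomain ℤ ℤ (D.circle α) v)) := by
    intro v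
    simp [φ, edgeMap]
  have hswap : ∀ v, δ * φ (ExteriorAlgebra.ι ℤ v) = -(φ (ExteriorAlgebra.ι ℤ v) * δ) := by
    intro v
    rw [hφι, hδ']
    exact eq_neg_of_add_eq_zero_left (ExteriorAlgebra.ι_add_mul_swap _ _)
  have hgen : ∀ v, δ * φ (ExteriorAlgebra.ι ℤ v) = δ * edgeMap β (ExteriorAlgebra.ι ℤ v) := by
    intro v
    induction v using Finsupp.induction_linear with
    | zero => simp
    | add v w hv hw => simp only [map_add, mul_add, hv, hw]
    | single e n =>
      have hs : (Finsupp.single e n : D.Edge →₀ ℤ) = n • Finsupp.single e 1 := by simp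
      rw [hs]
      simp only [map_zsmul, mul_smul_comm]
      congr 1
      have e1 : φ (ExteriorAlgebra.ι ℤ (Finsupp.single e 1)) =
          D.gen β (Quot.out (D.circle α e)) := by
        rw [hφι]
        simp [gen, transport]
      have e2 : edgeMap β (ExteriorAlgebra.ι ℤ (Finsupp.single e 1)) = D.gen β e :=
        edgeMap_edgeGen β e
      rw [e1, e2]
      rcases h _ _ (Quot.out_eq (D.circle α e)) with h | ⟨h1, h2⟩ | ⟨h1, h2⟩
      · rw [gen_congr h]
      · rw [gen_congr h1, gen_congr h2, ← sub_eq_zero, ← mul_sub, ← hδ, hsq]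
      · rw [gen_congr h1, gen_congr h2, ← sub_eq_zero, ← mul_sub, ← neg_sub, ← hδ, mul_neg, hsq,
          neg_zero]
  rw [hφ]
  induction w using CliffordAlgebra.left_induction with
  | algebraMap r => simp
  | add v w hv hw => simp only [map_add, mul_add, hv, hw]
  | ι_mul w v hw =>
    change δ * φ (ExteriorAlgebra.ι ℤ v * w) = δ * edgeMap β (ExteriorAlgebra.ι ℤ v * w)
    rw [map_mul, map_mul, ← mul_assoc, ← mul_assoc, ← hgen, hswap, neg_mul, mul_assoc, hw, neg_mul,
      mul_assoc]

open Classical in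
/-- The factor by which a saddle multiplies, in terms of edges. -/
noncomputable def saddleFactor (o : Fin D.n → Bool) (α : D.State) (x : Fin D.n) : D.EdgeAlg :=
  if D.IsMerge α x then 1 else D.chord o x

lemma saddle_edgeMap (o : Fin D.n → Bool) {α β : D.State} {x : Fin D.n} (hx : α x = false)
    (hβ : β = D.flip α x) (w : D.EdgeAlg) :
    D.saddle o x α β (edgeMap α w) = edgeMap β (saddleFactor o α x * w) := by
  subst hβ
  have hag : ∀ y, y ≠ x → α y = D.flip α x y := fun y hy => (flip_apply_of_ne α hy).symm
  unfold saddle saddleFactor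
  split_ifs with hm
  · rw [one_mul]
    exact transportMap_edgeMap (fun e e' he =>
      circle_eq_of_rot_eq o hag ((isMerge_iff_rot_eq o α x hx).1 hm) he) w
  · rw [map_mul, edgeMap_chord]
    exact mul_transportMap_edgeMap (fun e e' he => circle_eq_or o hag he) w

/-! ### Reversed saddles -/

open Classical in
/-- The map of the reversed saddle cobordism. -/
noncomputable def backSaddle (o : Fin D.n → Bool) (x : Fin D.n) (α β : D.State) :
    D.Lam β →ₗ[ℤ] D.Lam α :=
  if D.IsMerge α x then
    -- With this minus sign merges contribute head minus tail to the homotopy, as splits do through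
    -- the jump of S.
    -(LinearMap.mulLeft ℤ (D.gen α (D.rotTailEdge o x) - D.gen α (D.rotHeadEdge o x))).comp
      (D.transportMap β α)
  else D.transportMap β α

open Classical in
/-- The factor by which a reversed saddle multiplies, in terms of edges. -/
noncomputable def backFactor (o : Fin D.n → Bool) (α : D.State) (x : Fin D.n) : D.EdgeAlg :=
  if D.IsMerge α x then -D.chord o x else 1

lemma backSaddle_edgeMap (o : Fin D.n → Bool) {α β : D.State} {x : Fin D.n} (hx : α x = false)
    (hβ : β = D.flip α x) (w : D.EdgeAlg) :
    backSaddle o x α β (edgeMap β w) = edgeMap α (backFactor o α x * w) := by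
  subst hβ
  have hag : ∀ y, y ≠ x → D.flip α x y = α y := fun y hy => flip_apply_of_ne α hy
  unfold backSaddle backFactor
  split_ifs with hm
  · rw [map_mul, map_neg, edgeMap_chord, neg_mul]
    exact congrArg Neg.neg (mul_transportMap_edgeMap (fun e e' he => circle_eq_or o hag he) w)
  · rw [one_mul]
    exact transportMap_edgeMap (fun e e' he => circle_eq_of_rot_eq o hag
      (not_not.1 fun h' => hm ((isMerge_iff_rot_ne o α x hx).2 h')) he) w

end LinkDiagram

namespace LinkDiagram

variable {D : LinkDiagram}

/-! ### Elements of the exterior algebras which do not vanish -/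

/-- The factor 2 is what lets u • a + v • a = 0 determine the product of the signs u and v. -/
lemma two_smul_one_ne_zero (γ : D.State) : (2 : ℤ) • (1 : D.Lam γ) ≠ 0 := by
  intro h
  rw [← Algebra.algebraMap_eq_smul_one, ExteriorAlgebra.algebraMap_eq_zero_iff] at h
  norm_num at h

lemma exists_dual (γ : D.State) (χ : D.Edge → ℤ)
    (h : ∀ e e', D.circle γ e = D.circle γ e' → χ e = χ e') :
    ∃ d : Module.Dual ℤ (D.V γ), ∀ e, d (Finsupp.single (D.circle γ e) 1) = χ e := by
  let χ' : D.Circle γ → ℤ := Quot.lift χ fun e e' hj => h e e' (Quot.sound hj)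
  refine ⟨Finsupp.linearCombination ℤ χ', fun e => ?_⟩
  rw [Finsupp.linearCombination_single, one_smul]
  rfl

lemma edgeMap_chord_eq_ι (o : Fin D.n → Bool) (γ : D.State) (x : Fin D.n) :
    edgeMap γ (D.chord o x) = ExteriorAlgebra.ι ℤ (Finsupp.single (D.circle γ (D.rotTailEdge o x)) 1 -
      Finsupp.single (D.circle γ (D.rotHeadEdge o x)) 1) := by
  rw [edgeMap_chord, map_sub]
  rfl

lemma edgeMap_chord_eq_zero {o : Fin D.n → Bool} {γ : D.State} {x : Fin D.n}
    (h : D.circle γ (D.rotTailEdge o x) = D.circle γ (D.rotHeadEdge o x)) :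
    edgeMap γ (D.chord o x) = 0 := by
  rw [edgeMap_chord, gen_congr h, sub_self]

/-- Contraction with the functional that is 1 on the tail circle and 0 on the others takes the chord
to 1. -/
lemma two_smul_chord_ne_zero {o : Fin D.n → Bool} {γ : D.State} {x : Fin D.n}
    (h : D.circle γ (D.rotTailEdge o x) ≠ D.circle γ (D.rotHeadEdge o x)) :
    (2 : ℤ) • edgeMap γ (D.chord o x) ≠ 0 := by
  classical
  obtain ⟨d, hd⟩ := exists_dual γ
    (fun e => if D.circle γ e = D.circle γ (D.rotTailEdge o x) then 1 else 0)
    (fun e e' he => by simp only [he])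
  intro h0
  apply two_smul_one_ne_zero γ
  have := congrArg (CliffordAlgebra.contractLeft d) h0
  rw [edgeMap_chord_eq_ι, map_zsmul] at this
  erw [CliffordAlgebra.contractLeft_ι] at this
  rw [map_sub, hd, hd, if_pos rfl, if_neg h.symm, sub_zero, map_one, map_zero] at this
  exact this

/-- The functional that detects the circle of `α` at the tail of x is 1 on the chord of x and 0 on
that of y, whose ends share a circle of `α`. Contraction leaves the chord of y. -/
lemma two_smul_chord_mul_chord_ne_zero {o : Fin D.n → Bool} {α γ : D.State} {x y : Fin D.n}
    (hγ : ∀ e e', D.circle γ e = D.circle γ e' → D.circle α e = D.circle α e')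
    (hx : D.circle α (D.rotTailEdge o x) ≠ D.circle α (D.rotHeadEdge o x))
    (hy : D.circle α (D.rotTailEdge o y) = D.circle α (D.rotHeadEdge o y))
    (hy' : D.circle γ (D.rotTailEdge o y) ≠ D.circle γ (D.rotHeadEdge o y)) :
    (2 : ℤ) • edgeMap γ (D.chord o x * D.chord o y) ≠ 0 := by
  classical
  obtain ⟨d, hd⟩ := exists_dual γ
    (fun e => if D.circle α e = D.circle α (D.rotTailEdge o x) then 1 else 0)
    (fun e e' he => by simp only [hγ e e' he])
  intro h0
  apply two_smul_chord_ne_zero hy'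
  have := congrArg (CliffordAlgebra.contractLeft d) h0
  rw [map_mul, edgeMap_chord_eq_ι o γ x, map_zsmul] at this
  erw [CliffordAlgebra.contractLeft_ι_mul] at this
  rw [edgeMap_chord_eq_ι o γ y] at this
  erw [CliffordAlgebra.contractLeft_ι] at this
  rw [map_sub d, hd, hd, map_sub d, hd, hd, hy, if_pos rfl, if_neg hx.symm, sub_zero, sub_self,
    map_zero, mul_zero, sub_zero, one_smul, map_zero, ← edgeMap_chord_eq_ι] at this
  exact this

/-! ### Signs -/

section Signs

variable {A : Type*} [AddCommGroup A] {u v : ℤˣ} {a : A}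

lemma units_smul_add_smul (h : u * v = -1) : u • a + v • a = 0 := by
  rcases Int.units_eq_one_or u with rfl | rfl <;> rcases Int.units_eq_one_or v with rfl | rfl <;>
    simp_all

lemma units_smul_add_smul_neg (h : u * v = 1) : u • a + v • (-a) = 0 := by
  rcases Int.units_eq_one_or u with rfl | rfl <;> rcases Int.units_eq_one_or v with rfl | rfl <;>
    simp_all

lemma units_mul_of_smul_add_smul (h : u • a + v • a = 0) (ha : (2 : ℤ) • a ≠ 0) : u * v = -1 := by
  rcases Int.units_eq_one_or u with rfl | rfl <;> rcases Int.units_eq_one_or v with rfl | rfl <;>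
    simp_all [two_zsmul]
  apply ha
  rw [← neg_eq_zero, neg_add, h]

lemma units_mul_of_smul_add_smul_neg (h : u • a + v • (-a) = 0) (ha : (2 : ℤ) • a ≠ 0) :
    u * v = 1 := by
  rcases Int.units_eq_one_or u with rfl | rfl <;> rcases Int.units_eq_one_or v with rfl | rfl <;>
    simp_all [two_zsmul]
  apply ha
  rw [← neg_eq_zero, neg_add, h]

end Signs

lemma chord_mul_chord (o : Fin D.n → Bool) (x y : Fin D.n) :
    D.chord o y * D.chord o x = -(D.chord o x * D.chord o y) := by
  have : ∀ z, D.chord o z = ExteriorAlgebra.ι ℤ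
      (Finsupp.single (D.rotTailEdge o z) 1 - Finsupp.single (D.rotHeadEdge o z) 1) := by
    intro z
    rw [map_sub]
    rfl
  rw [this, this]
  exact eq_neg_of_add_eq_zero_left (ExteriorAlgebra.ι_add_mul_swap _ _)

/-! ### Faces of the cube: saddles against reversed saddles -/

section Face

variable {o : Fin D.n → Bool} {ε : D.State → Fin D.n → ℤˣ} {α : D.State} {x y : Fin D.n}

/-- Evaluation of the face relation at 1 leaves only the factors of the saddles. -/
lemma IsValidSign.saddleFactor_anticommute (hε : D.IsValidSign o ε) (hxy : x ≠ y) (hx : α x = false)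
    (hy : α y = false) :
    (ε α x * ε (D.flip α x) y) • edgeMap (D.flip (D.flip α x) y)
        (saddleFactor o (D.flip α x) y * saddleFactor o α x) +
      (ε α y * ε (D.flip α y) x) • edgeMap (D.flip (D.flip α x) y)
        (saddleFactor o (D.flip α y) x * saddleFactor o α y) = 0 := by
  have h := LinearMap.congr_fun (hε.anticommute α x y hxy hx hy) (edgeMap α 1)
  have hxy' : D.flip α x y = false := (flip_apply_eq_false_iff _ _ _).2 ⟨hxy, hy⟩
  have hyx' : D.flip α y x = false := (flip_apply_eq_false_iff _ _ _).2 ⟨hxy.symm, hx⟩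
  simp only [LinearMap.add_apply, LinearMap.smul_apply, LinearMap.comp_apply,
    LinearMap.zero_apply] at h
  rw [saddle_edgeMap o hx rfl, saddle_edgeMap o hxy' rfl, saddle_edgeMap o hy rfl,
    saddle_edgeMap o hyx' (flip_flip_comm α hxy), mul_one, mul_one] at h
  exact h

/-- Both paths around a face change the number of circles equally, so they contain equally many
merges. This leaves 6 of the 16 patterns of merges and splits. -/
lemma card_circle_face (hxy : x ≠ y) (hx : α x = false) (hy : α y = false) [Decidable (D.IsMerge α x)]
    [Decidable (D.IsMerge (D.flip α x) y)] [Decidable (D.IsMerge α y)]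
    [Decidable (D.IsMerge (D.flip α y) x)] :
    (if D.IsMerge α x then 1 else 0) + (if D.IsMerge (D.flip α x) y then 1 else 0) =
      (if D.IsMerge α y then 1 else 0) + (if D.IsMerge (D.flip α y) x then 1 else 0) := by
  have hxy' : D.flip α x y = false := (flip_apply_eq_false_iff _ _ _).2 ⟨hxy, hy⟩
  have hyx' : D.flip α y x = false := (flip_apply_eq_false_iff _ _ _).2 ⟨hxy.symm, hx⟩
  have count : ∀ (α : D.State) (x : Fin D.n) [Decidable (D.IsMerge α x)], α x = false →
      Nat.card (D.Circle (D.flip α x)) + 2 * (if D.IsMerge α x then 1 else 0) =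
        Nat.card (D.Circle α) + 1 := by
    intro α x _ hx
    split_ifs with h
    · rw [card_circle_of_isMerge hx h]
    · rw [card_circle_of_not_isMerge hx h]
  have c1 := count α x hx
  have c2 := count _ y hxy'
  have c3 := count α y hy
  have c4 := count _ x hyx'
  rw [← flip_flip_comm α hxy] at c4
  omega

/-- The reversed saddle at one crossing and the saddle at another one anticommute. -/
lemma IsValidSign.backFactor_anticommute (hε : D.IsValidSign o ε) (hxy : x ≠ y) (hx : α x = false)
    (hy : α y = false) (w : D.EdgeAlg) :
    ((-1) ^ D.signExponent α * ε α x * ε α y) •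
        edgeMap (D.flip α y) (saddleFactor o α y * (backFactor o α x * w)) +
      ((-1) ^ D.signExponent (D.flip α y) * ε (D.flip α y) x * ε (D.flip α x) y) •
        edgeMap (D.flip α y) (backFactor o (D.flip α y) x * (saddleFactor o (D.flip α x) y * w)) =
      0 := by
  classical
  have hxy' : D.flip α x y = false := (flip_apply_eq_false_iff _ _ _).2 ⟨hxy, hy⟩
  have hyx' : D.flip α y x = false := (flip_apply_eq_false_iff _ _ _).2 ⟨hxy.symm, hx⟩
  have hcount := card_circle_face (D := D) hxy hx hy
  have hface := hε.saddleFactor_anticommute hxy hx hy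
  have hcomm := flip_flip_comm α hxy
  have hs : ∀ s : ℤˣ, s * s = 1 := fun s => Int.units_mul_self s
  -- The two signs in the goal multiply to the product of the four face signs, up to the change of S
  -- along y.
  have hsame : D.signExponent (D.flip α y) = D.signExponent α →
      ((-1) ^ D.signExponent α * ε α x * ε α y) *
      ((-1) ^ D.signExponent (D.flip α y) * ε (D.flip α y) x * ε (D.flip α x) y) =
      (ε α x * ε (D.flip α x) y) * (ε α y * ε (D.flip α y) x) := by
    intro h
    rw [h]
    have := hs ((-1) ^ D.signExponent α)
    calc _ = ((-1) ^ D.signExponent α * (-1) ^ D.signExponent α) *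
        ((ε α x * ε (D.flip α x) y) * (ε α y * ε (D.flip α y) x)) := by ac_rfl
      _ = _ := by rw [this, one_mul]
  have hdiff : D.signExponent (D.flip α y) = D.signExponent α + 1 →
      ((-1) ^ D.signExponent α * ε α x * ε α y) *
      ((-1) ^ D.signExponent (D.flip α y) * ε (D.flip α y) x * ε (D.flip α x) y) =
      -((ε α x * ε (D.flip α x) y) * (ε α y * ε (D.flip α y) x)) := by
    intro h
    rw [h, pow_succ]
    have := hs ((-1) ^ D.signExponent α)
    calc _ = ((-1) ^ D.signExponent α * (-1) ^ D.signExponent α) *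
        ((-1) * ((ε α x * ε (D.flip α x) y) * (ε α y * ε (D.flip α y) x))) := by ac_rfl
      _ = _ := by rw [this, one_mul, neg_one_mul]
  by_cases m1 : D.IsMerge α x <;> by_cases m2 : D.IsMerge (D.flip α x) y <;>
    by_cases m3 : D.IsMerge α y <;> by_cases m4 : D.IsMerge (D.flip α y) x <;>
    simp only [m1, m2, m3, m4, if_true, if_false, Nat.reduceAdd, zero_add, add_zero,
      one_ne_zero, zero_ne_one, OfNat.ofNat_ne_one, OfNat.one_ne_ofNat, OfNat.ofNat_ne_zero,
      OfNat.zero_ne_ofNat] at hcount <;>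
    simp only [saddleFactor, backFactor, m1, m2, m3, m4, if_true, if_false, one_mul, mul_one] at hface ⊢
  · exact units_smul_add_smul ((hsame (signExponent_of_isMerge hy m3)).trans
      (units_mul_of_smul_add_smul hface (by rw [map_one]; exact two_smul_one_ne_zero _)))
  -- Both crossings join the same two circles. After the merge along y both chords vanish, so no
  -- sign is needed.
  · have ex : edgeMap (D.flip α y) (D.chord o x) = 0 := edgeMap_chord_eq_zero
      (not_not.1 fun h => m4 ((isMerge_iff_rot_ne o _ x hyx').2 h))
    have ey : edgeMap (D.flip α y) (D.chord o y) = 0 := edgeMap_chord_eq_zero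
      ((isMerge_iff_rot_eq o _ y hy).1 m3)
    rw [map_mul, map_mul, map_neg, ex, ey, neg_zero, zero_mul, smul_zero, smul_zero, add_zero]
  · have hne := two_smul_chord_ne_zero (mt (isMerge_iff_rot_eq o _ y hxy').2 m2)
    have hP := units_mul_of_smul_add_smul hface hne
    have e1 : D.chord o y * (-D.chord o x * w) = -(-D.chord o x * (D.chord o y * w)) := by
      rw [neg_mul, neg_mul, mul_neg, ← mul_assoc, ← mul_assoc, chord_mul_chord o x y, neg_mul]
    rw [e1, map_neg, add_comm]
    refine units_smul_add_smul_neg ?_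
    rw [mul_comm, hdiff (signExponent_of_not_isMerge hy m3), hP, neg_neg]
  · have hne := two_smul_chord_ne_zero (mt (isMerge_iff_rot_eq o _ x hyx').2 m4)
    rw [← hcomm] at hne
    exact units_smul_add_smul ((hsame (signExponent_of_isMerge hy m3)).trans
      (units_mul_of_smul_add_smul hface hne))
  -- Both forward composites vanish. After the split along y, x connects the two new circles, so the
  -- chords agree up to sign: equal in type X, opposite in type Y. The convention supplies the
  -- matching face sign.
  · have hXY : D.IsTypeXY α y x := ⟨m3, m1, m4, m2⟩
    have ht : D.circle (D.flip α y) (D.tailEdge o x) = D.circle (D.flip α y) (D.rotHeadEdge o x) := by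
      have c0 := circle_turn (D.flip α y) x 0
      have c2 := circle_turn (D.flip α y) x 2
      rw [hyx'] at c0 c2
      unfold tailEdge rotHeadEdge
      cases o x
      · exact c0
      · exact c2
    have hxne := (isMerge_iff_rot_ne o _ x hyx').1 m4
    have hxα : D.circle α (D.rotTailEdge o x) = D.circle α (D.rotHeadEdge o x) :=
      not_not.1 fun h => m1 ((isMerge_iff_rot_ne o _ x hx).2 h)
    have hP : (ε α x * ε (D.flip α x) y) * (ε α y * ε (D.flip α y) x) =
        ε α y * ε (D.flip α y) x * ε α x * ε (D.flip α x) y := by ac_rfl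
    have hP' := hdiff (signExponent_of_not_isMerge hy m3)
    rw [hP] at hP'
    rw [neg_mul, map_neg, map_mul, map_mul]
    rcases (circle_eq_or o (fun z hz => (flip_apply_of_ne α hz).symm) hxα).resolve_left hxne with
      ⟨h1, h2⟩ | ⟨h1, h2⟩
    · have hY : ¬ D.IsTypeY o α y x := by
        intro h
        exact hxne (h1.trans (h.symm.trans ht))
      rw [hε.typeX α y x hxy.symm hy hx hXY hY, neg_neg] at hP'
      have : edgeMap (D.flip α y) (D.chord o x) = edgeMap (D.flip α y) (D.chord o y) := by
        rw [edgeMap_chord, edgeMap_chord, gen_congr h1, gen_congr h2]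
      rw [this]
      exact units_smul_add_smul_neg hP'
    · have hY : D.IsTypeY o α y x := ht.trans h2
      rw [hε.typeY α y x hxy.symm hy hx hXY hY] at hP'
      have : edgeMap (D.flip α y) (D.chord o x) = -edgeMap (D.flip α y) (D.chord o y) := by
        rw [edgeMap_chord, edgeMap_chord, gen_congr h1, gen_congr h2, neg_sub]
      rw [this, neg_mul, neg_neg]
      exact units_smul_add_smul hP'
  · have hne : (2 : ℤ) • edgeMap (D.flip (D.flip α x) y) (D.chord o x * D.chord o y) ≠ 0 :=
      two_smul_chord_mul_chord_ne_zero (α := D.flip α x)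
        (fun e e' he => circle_eq_of_rot_eq o (fun z hz => flip_apply_of_ne _ hz)
          (not_not.1 fun h => m2 ((isMerge_iff_rot_ne o _ y hxy').2 h)) he)
        (mt (isMerge_iff_rot_eq o _ x hx).2 m1)
        (not_not.1 fun h => m2 ((isMerge_iff_rot_ne o _ y hxy').2 h))
        (mt (isMerge_iff_rot_eq o _ y hxy').2 m2)
    rw [chord_mul_chord o x y, map_neg, add_comm] at hface
    have hP := units_mul_of_smul_add_smul_neg hface hne
    refine units_smul_add_smul ?_
    rw [hdiff (signExponent_of_not_isMerge hy m3), mul_comm, hP]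

end Face

end LinkDiagram

namespace LinkDiagram

variable {D : LinkDiagram}

/-! ### The cube of resolutions without its grading -/

variable (D) in
/-- The sum of the groups at all vertices of the cube. -/
abbrev Cube : Type := ∀ α : D.State, D.Lam α

/-- The part of the differential which changes the resolution of one crossing. -/
noncomputable def cubeStep (o : Fin D.n → Bool) (ε : D.State → Fin D.n → ℤˣ) (x : Fin D.n) :
    D.Cube →ₗ[ℤ] D.Cube :=
  LinearMap.pi fun β => if β x = true then
    ε (Function.update β x false) x •
      (D.saddle o x (Function.update β x false) β).comp (LinearMap.proj (Function.update β x false))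
    else 0

/-- The signed sum of the reversed saddles at a crossing. -/
noncomputable def cubeBack (o : Fin D.n → Bool) (ε : D.State → Fin D.n → ℤˣ) (x : Fin D.n) :
    D.Cube →ₗ[ℤ] D.Cube :=
  LinearMap.pi fun α => if α x = false then
    ((-1) ^ D.signExponent α * ε α x) •
      (backSaddle o x α (D.flip α x)).comp (LinearMap.proj (D.flip α x))
    else 0

lemma update_flip (α : D.State) {x : Fin D.n} (hx : α x = false) :
    Function.update (D.flip α x) x false = α := by
  unfold flip
  rw [Function.update_idem, ← hx, Function.update_eq_self]

lemma flip_update (β : D.State) {x : Fin D.n} (hx : β x = true) :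
    D.flip (Function.update β x false) x = β := by
  unfold flip
  rw [Function.update_idem, ← hx, Function.update_eq_self]

lemma exists_eq_flip (β : D.State) {x : Fin D.n} (hx : β x = true) :
    ∃ α : D.State, α x = false ∧ β = D.flip α x :=
  ⟨Function.update β x false, by simp, (flip_update β hx).symm⟩

section Operators

variable (o : Fin D.n → Bool) (ε : D.State → Fin D.n → ℤˣ) (f : D.Cube)

lemma cubeStep_apply {α β : D.State} {x : Fin D.n} (hx : α x = false) (hβ : β = D.flip α x) :
    cubeStep o ε x f β = ε α x • D.saddle o x α β (f α) := by
  have hβx : β x = true := by rw [hβ, flip_apply_self]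
  have key : ∀ α', α' = α → ε α' x • D.saddle o x α' β (f α') = ε α x • D.saddle o x α β (f α) := by
    rintro _ rfl
    rfl
  rw [cubeStep, LinearMap.pi_apply, if_pos hβx]
  exact key _ (by rw [hβ, update_flip α hx])

lemma cubeStep_apply_of_false {β : D.State} {x : Fin D.n} (hx : β x = false) :
    cubeStep o ε x f β = 0 := by
  rw [cubeStep, LinearMap.pi_apply, if_neg (by simp [hx]), LinearMap.zero_apply]

lemma cubeBack_apply {α β : D.State} {x : Fin D.n} (hx : α x = false) (hβ : β = D.flip α x) :
    cubeBack o ε x f α =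
      ((-1) ^ D.signExponent α * ε α x) • backSaddle o x α β (f β) := by
  subst hβ
  rw [cubeBack, LinearMap.pi_apply, if_pos hx]
  rfl

lemma cubeBack_apply_of_true {α : D.State} {x : Fin D.n} (hx : α x = true) :
    cubeBack o ε x f α = 0 := by
  rw [cubeBack, LinearMap.pi_apply, if_neg (by simp [hx]), LinearMap.zero_apply]

variable {ε} in
lemma cubeStep_cubeBack_of_ne (hε : D.IsValidSign o ε) {x y : Fin D.n} (hxy : x ≠ y) :
    cubeStep o ε y (cubeBack o ε x f) + cubeBack o ε x (cubeStep o ε y f) = 0 := by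
  funext δ
  rw [Pi.add_apply, Pi.zero_apply]
  cases hδx : δ x
  · cases hδy : δ y
    · rw [cubeStep_apply_of_false _ _ _ hδy, cubeBack_apply _ _ _ hδx rfl,
        cubeStep_apply_of_false _ _ _ (by rwa [flip_apply_of_ne _ hxy.symm]), map_zero, smul_zero,
        add_zero]
    -- Only vertices with resolution 0 at x and 1 at y receive contributions; both come from the
    -- neighbor of `α` along x.
    · obtain ⟨α, hy, rfl⟩ := exists_eq_flip δ hδy
      have hx : α x = false := by rwa [flip_apply_of_ne _ hxy] at hδx
      have hxy' : D.flip α x y = false := (flip_apply_eq_false_iff _ _ _).2 ⟨hxy, hy⟩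
      obtain ⟨w, hw⟩ := edgeMap_surjective (D.flip α x) (f (D.flip α x))
      rw [cubeStep_apply _ _ _ hy rfl, cubeBack_apply _ _ _ hx rfl,
        cubeBack_apply _ _ _ hδx (flip_flip_comm α hxy), cubeStep_apply _ _ _ hxy' rfl, ← hw,
        LinearMap.map_smul_of_tower, LinearMap.map_smul_of_tower, smul_smul, smul_smul,
        backSaddle_edgeMap o hx rfl, saddle_edgeMap o hy rfl, saddle_edgeMap o hxy' rfl,
        backSaddle_edgeMap o hδx (flip_flip_comm α hxy), mul_comm (ε α y)]
      exact hε.backFactor_anticommute hxy hx hy w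
  · rw [cubeBack_apply_of_true _ _ _ hδx, add_zero]
    cases hδy : δ y
    · rw [cubeStep_apply_of_false _ _ _ hδy]
    · obtain ⟨α, hy, rfl⟩ := exists_eq_flip δ hδy
      rw [flip_apply_of_ne _ hxy] at hδx
      rw [cubeStep_apply _ _ _ hy rfl, cubeBack_apply_of_true _ _ _ hδx, map_zero, smul_zero]

/-- At each vertex only one of the composites is present. Of a saddle and its reverse exactly one
carries the chord, and where the two ends of the chord lie on one circle both sides vanish. -/
lemma cubeStep_cubeBack_self (x : Fin D.n) (δ : D.State) :
    cubeStep o ε x (cubeBack o ε x f) δ + cubeBack o ε x (cubeStep o ε x f) δ =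
      (-1 : ℤˣ) ^ D.signExponent δ •
        ((D.gen δ (D.rotHeadEdge o x) - D.gen δ (D.rotTailEdge o x)) * f δ) := by
  have hs : ∀ (s u : ℤˣ), s * u * u = s := fun s u => by
    rw [mul_assoc, Int.units_mul_self, mul_one]
  obtain ⟨w, hw⟩ := edgeMap_surjective δ (f δ)
  rw [← neg_sub, ← edgeMap_chord, ← hw, ← map_neg, ← map_mul]
  cases hδ : δ x
  · rw [cubeStep_apply_of_false _ _ _ hδ, zero_add, cubeBack_apply _ _ _ hδ rfl,
      cubeStep_apply _ _ _ hδ rfl, ← hw, LinearMap.map_smul_of_tower, smul_smul, hs,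
      saddle_edgeMap o hδ rfl, backSaddle_edgeMap o hδ rfl]
    congr 1
    unfold saddleFactor backFactor
    split_ifs with hm
    · rw [one_mul]
    · have := edgeMap_chord_eq_zero (not_not.1 fun h => hm ((isMerge_iff_rot_ne o _ x hδ).2 h))
      rw [one_mul, map_mul, map_mul, map_neg, this, neg_zero]
  · obtain ⟨α, hx, rfl⟩ := exists_eq_flip δ hδ
    rw [cubeBack_apply_of_true _ _ _ hδ, add_zero, cubeStep_apply _ _ _ hx rfl,
      cubeBack_apply _ _ _ hx rfl, ← hw, LinearMap.map_smul_of_tower, smul_smul, mul_comm, hs,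
      backSaddle_edgeMap o hx rfl, saddle_edgeMap o hx rfl]
    unfold saddleFactor backFactor
    split_ifs with hm
    · have := edgeMap_chord_eq_zero ((isMerge_iff_rot_eq o _ x hx).1 hm)
      rw [one_mul, map_mul, map_neg, this, neg_zero, zero_mul, smul_zero, smul_zero]
    · rw [one_mul, signExponent_of_not_isMerge hx hm, pow_succ, mul_neg_one, neg_mul, map_neg,
        Units.neg_smul, smul_neg, neg_neg]

variable {ε} in
lemma sum_cubeStep_cubeBack (hε : D.IsValidSign o ε) (x : Fin D.n) (δ : D.State) :
    (∑ y, cubeStep o ε y (cubeBack o ε x f)) δ + cubeBack o ε x (∑ y, cubeStep o ε y f) δ =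
      (-1 : ℤˣ) ^ D.signExponent δ •
        ((D.gen δ (D.rotHeadEdge o x) - D.gen δ (D.rotTailEdge o x)) * f δ) := by
  rw [map_sum, ← Pi.add_apply, ← Finset.sum_add_distrib, Finset.sum_eq_single x, Pi.add_apply,
    cubeStep_cubeBack_self]
  · intro y _ hy
    exact cubeStep_cubeBack_of_ne o f hε hy.symm
  · simp

end Operators

/-! ### The grading -/

/-- The extension of a chain by zero. -/
noncomputable def extend (i : ℤ) : D.Chain i →ₗ[ℤ] D.Cube where
  toFun f α := if h : (D.deg α : ℤ) = i + D.nNeg then f ⟨α, h⟩ else 0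
  map_add' f g := by
    funext α
    by_cases h : (D.deg α : ℤ) = i + D.nNeg <;> simp [h]
  map_smul' c f := by
    funext α
    by_cases h : (D.deg α : ℤ) = i + D.nNeg <;> simp [h]

/-- The component of a degree. -/
noncomputable def restrict (i : ℤ) : D.Cube →ₗ[ℤ] D.Chain i := LinearMap.pi fun α => LinearMap.proj α.1

lemma restrict_apply (i : ℤ) (g : D.Cube) (α : D.StateIn i) : restrict i g α = g α.1 := rfl

lemma extend_apply_coe (i : ℤ) (f : D.Chain i) (α : D.StateIn i) : extend i f α.1 = f α :=
  dif_pos α.2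

lemma extend_apply_of_ne {i : ℤ} (f : D.Chain i) {α : D.State}
    (h : (D.deg α : ℤ) ≠ i + D.nNeg) : extend i f α = 0 :=
  dif_neg h

lemma extend_restrict {i : ℤ} {g : D.Cube}
    (h : ∀ α, (D.deg α : ℤ) ≠ i + D.nNeg → g α = 0) : extend i (restrict i g) = g := by
  funext α
  by_cases hα : (D.deg α : ℤ) = i + D.nNeg
  · exact extend_apply_coe i _ ⟨α, hα⟩
  · rw [extend_apply_of_ne _ hα, h α hα]

section Graded

variable (o : Fin D.n → Bool) (ε : D.State → Fin D.n → ℤˣ)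

lemma diff_eq_restrict (i j : ℤ) (f : D.Chain i) :
    D.diff o ε i j f = restrict j (∑ x, cubeStep o ε x (extend i f)) := by
  funext β
  rw [diff_apply, restrict_apply, Finset.sum_apply, Finset.sum_comm]
  refine Finset.sum_congr rfl fun x _ => ?_
  cases hx : β.1 x
  · rw [cubeStep_apply_of_false _ _ _ hx]
    refine Finset.sum_eq_zero fun α _ => if_neg ?_
    rintro ⟨-, h⟩
    rw [h, flip_apply_self] at hx
    exact Bool.noConfusion hx
  · obtain ⟨α, hα, hβ⟩ := exists_eq_flip β.1 hx
    have huniq : ∀ α' : D.State, α' x = false → β.1 = D.flip α' x → α' = α := by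
      intro α' h h'
      rw [← update_flip α' h, ← h', hβ, update_flip α hα]
    rw [cubeStep_apply _ _ _ hα hβ]
    by_cases hd : (D.deg α : ℤ) = i + D.nNeg
    · rw [Finset.sum_eq_single ⟨α, hd⟩, if_pos ⟨hα, hβ⟩, ← extend_apply_coe i f]
      · intro α' _ hne
        refine if_neg ?_
        rintro ⟨h, h'⟩
        exact hne (Subtype.ext (huniq _ h h'))
      · simp
    · rw [extend_apply_of_ne _ hd, map_zero, smul_zero]
      refine Finset.sum_eq_zero fun α' _ => if_neg ?_
      rintro ⟨h, h'⟩
      exact hd (huniq _ h h' ▸ α'.2)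

/-- The component `Chain i → Chain j` of the signed sum of the reversed saddles at a crossing. -/
noncomputable def back (x : Fin D.n) (i j : ℤ) : D.Chain i →ₗ[ℤ] D.Chain j :=
  (restrict j).comp ((cubeBack o ε x).comp (extend i))

lemma cubeBack_extend_eq_zero {x : Fin D.n} {i : ℤ} (f : D.Chain i) {α : D.State}
    (h : (D.deg α : ℤ) + 1 ≠ i + D.nNeg) : cubeBack o ε x (extend i f) α = 0 := by
  cases hx : α x
  · rw [cubeBack_apply _ _ _ hx rfl, extend_apply_of_ne, map_zero, smul_zero]
    rw [deg_flip α x hx]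
    exact_mod_cast h
  · exact cubeBack_apply_of_true _ _ _ hx

lemma cubeStep_extend_eq_zero {x : Fin D.n} {i : ℤ} (f : D.Chain i) {β : D.State}
    (h : (D.deg β : ℤ) ≠ i + D.nNeg + 1) : cubeStep o ε x (extend i f) β = 0 := by
  cases hx : β x
  · exact cubeStep_apply_of_false _ _ _ hx
  · obtain ⟨α, hα, rfl⟩ := exists_eq_flip β hx
    rw [cubeStep_apply _ _ _ hα rfl, extend_apply_of_ne, map_zero, smul_zero]
    rw [deg_flip α x hα] at h
    intro h'
    apply h
    push_cast
    rw [h']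

lemma back_eq_zero (x : Fin D.n) {i j : ℤ} (h : j + 1 ≠ i) : back o ε x i j = 0 := by
  refine LinearMap.ext fun f => funext fun α => ?_
  refine cubeBack_extend_eq_zero o ε f ?_
  rw [α.2]
  omega

lemma dot_apply (e : D.Edge) (i : ℤ) (f : D.Chain i) (α : D.StateIn i) :
    D.dot e i f α = (-1 : ℤˣ) ^ D.signExponent α.1 • (D.gen α.1 e * f α) := rfl

variable {ε} in
lemma diff_back_add_back_diff (hε : D.IsValidSign o ε) (x : Fin D.n) (i : ℤ) (f : D.Chain i) :
    D.diff o ε (i - 1) i (back o ε x i (i - 1) f) + back o ε x (i + 1) i (D.diff o ε i (i + 1) f) =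
      D.dot (D.rotHeadEdge o x) i f - D.dot (D.rotTailEdge o x) i f := by
  -- Reversed saddles and saddles shift the degree by exactly one, so restricting to that degree and
  -- extending by zero loses nothing.
  have e1 : extend (i - 1) (back o ε x i (i - 1) f) = cubeBack o ε x (extend i f) :=
    extend_restrict fun α hα => cubeBack_extend_eq_zero o ε f (by omega)
  have e2 : extend (i + 1) (D.diff o ε i (i + 1) f) = ∑ y, cubeStep o ε y (extend i f) := by
    rw [diff_eq_restrict]
    refine extend_restrict fun α hα => ?_
    rw [Finset.sum_apply]
    exact Finset.sum_eq_zero fun y _ => cubeStep_extend_eq_zero o ε f (by omega)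
  funext δ
  rw [diff_eq_restrict, e1, back, LinearMap.comp_apply, LinearMap.comp_apply, e2, Pi.add_apply,
    restrict_apply, restrict_apply, sum_cubeStep_cubeBack o _ hε, Pi.sub_apply, dot_apply, dot_apply,
    extend_apply_coe, sub_mul, smul_sub]

lemma saddle_gen_mul {α β : D.State} {x : Fin D.n} (hx : α x = false) (hβ : β = D.flip α x)
    (e : D.Edge) (v : D.Lam α) :
    D.saddle o x α β ((-1 : ℤˣ) ^ D.signExponent α • (D.gen α e * v)) =
      (-1 : ℤˣ) ^ D.signExponent β • (D.gen β e * D.saddle o x α β v) := by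
  obtain ⟨w, rfl⟩ := edgeMap_surjective α v
  rw [← edgeMap_edgeGen, ← edgeMap_edgeGen, ← map_mul, LinearMap.map_smul_of_tower,
    saddle_edgeMap o hx hβ, saddle_edgeMap o hx hβ, ← map_mul]
  subst hβ
  unfold saddleFactor
  split_ifs with hm
  · rw [signExponent_of_isMerge hx hm, one_mul, one_mul]
  · have hanti : ∀ a : D.Edge, D.edgeGen a * D.edgeGen e = -(D.edgeGen e * D.edgeGen a) := fun a =>
      eq_neg_of_add_eq_zero_left (ExteriorAlgebra.ι_add_mul_swap _ _)
    have : D.chord o x * D.edgeGen e = -(D.edgeGen e * D.chord o x) := by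
      rw [chord, sub_mul, hanti, hanti, mul_sub]
      abel
    rw [signExponent_of_not_isMerge hx hm, ← mul_assoc, this, pow_succ, mul_neg_one, neg_mul, map_neg,
      Units.neg_smul, smul_neg, mul_assoc]

lemma diff_dot (e : D.Edge) (i j : ℤ) (f : D.Chain i) :
    D.diff o ε i j (D.dot e i f) = D.dot e j (D.diff o ε i j f) := by
  funext β
  rw [dot_apply, diff_apply, diff_apply, Finset.mul_sum, Finset.smul_sum]
  refine Finset.sum_congr rfl fun α _ => ?_
  rw [Finset.mul_sum, Finset.smul_sum]
  refine Finset.sum_congr rfl fun x _ => ?_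
  split_ifs with h
  · rw [dot_apply, saddle_gen_mul o h.1 h.2, mul_smul_comm, smul_comm]
  · rw [mul_zero, smul_zero]

end Graded

lemma dot_dot (e e' : D.Edge) (i : ℤ) (f : D.Chain i) :
    D.dot e i (D.dot e' i f) = -D.dot e' i (D.dot e i f) := by
  funext α
  simp only [dot_apply, Pi.neg_apply, mul_smul_comm, ← mul_assoc, gen_mul_gen α.1 e e', neg_mul,
    smul_neg]

lemma dot_dot_self (e : D.Edge) (i : ℤ) (f : D.Chain i) : D.dot e i (D.dot e i f) = 0 := by
  funext α
  simp only [dot_apply, Pi.zero_apply, mul_smul_comm, ← mul_assoc, gen_mul_self, zero_mul,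
    smul_zero]

/-- Resolution 0 pairs the under edges 0, 2 with the over edges 1, 3; resolution 1 pairs them with
3, 1. -/
lemma dot_over_add_dot_over (x : Fin D.n) (i : ℤ) :
    D.dot (D.edge x 1) i + D.dot (D.edge x 3) i = D.dot (D.edge x 0) i + D.dot (D.edge x 2) i := by
  refine LinearMap.ext fun f => funext fun α => ?_
  have c0 := gen_congr (circle_turn α.1 x 0)
  have c2 := gen_congr (circle_turn α.1 x 2)
  simp only [LinearMap.add_apply, Pi.add_apply, dot_apply, ← smul_add, ← add_mul]
  rw [c0, c2]
  cases α.1 x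
  · rfl
  · rw [add_comm (D.gen α.1 (D.edge x 1))]
    rfl

end LinkDiagram

/-! ### Square-zero combinations of anticommuting elements -/

namespace ExteriorAlgebra

/-- Linear combinations of anticommuting elements with square zero have square zero. -/
lemma linearCombination_mul_self {E A : Type*} [Ring A] (φ : E → A)
    (hanti : ∀ e e', φ e * φ e' = -(φ e' * φ e)) (hsq : ∀ e, φ e * φ e = 0) (v : E →₀ ℤ) :
    Finsupp.linearCombination ℤ φ v * Finsupp.linearCombination ℤ φ v = 0 := by
  have hanti' : ∀ v w, Finsupp.linearCombination ℤ φ v * Finsupp.linearCombination ℤ φ w =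
      -(Finsupp.linearCombination ℤ φ w * Finsupp.linearCombination ℤ φ v) := by
    intro v w
    induction v using Finsupp.induction_linear with
    | zero => simp
    | add v v' h h' => rw [map_add, add_mul, mul_add, h, h', neg_add]
    | single e n =>
      induction w using Finsupp.induction_linear with
      | zero => simp
      | add w w' h h' => rw [map_add, add_mul, mul_add, h, h', neg_add]
      | single e' m =>
        simp only [Finsupp.linearCombination_single, smul_mul_smul_comm, hanti e e', smul_neg,
          mul_comm n m]
  induction v using Finsupp.induction_linear with
  | zero => simp
  | add v w hv hw => rw [map_add, add_mul, mul_add, mul_add, hv, hw, hanti' v w]; abel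
  | single e n =>
    rw [Finsupp.linearCombination_single, smul_mul_smul_comm, hsq, smul_zero]

end ExteriorAlgebra

namespace LinkDiagram

open CategoryTheory

variable {D : LinkDiagram} {o : Fin D.n → Bool} {ε : D.State → Fin D.n → ℤˣ}
  (hε : D.IsValidSign o ε)

/-! ### The action on homology -/

/-- The chain map of the identity cobordism with a dot. -/
noncomputable def dotMap (e : D.Edge) :
    D.oddKhovanovComplex o ε hε ⟶ D.oddKhovanovComplex o ε hε where
  f i := ModuleCat.ofHom (D.dot e i)
  comm' i j _ := by
    ext f : 2
    exact diff_dot o ε e i j f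

/-- The components of the homotopy of a crossing, between the groups of the complex. -/
noncomputable def backHom (x : Fin D.n) (i j : ℤ) :
    (D.oddKhovanovComplex o ε hε).X i ⟶ (D.oddKhovanovComplex o ε hε).X j :=
  ModuleCat.ofHom (back o ε x i j)

/-- The dots on the two edges of an over strand are homotopic. -/
noncomputable def dotHomotopy (x : Fin D.n) :
    Homotopy (dotMap hε (D.rotHeadEdge o x)) (dotMap hε (D.rotTailEdge o x)) where
  hom := backHom hε x
  zero i j h := by
    rw [backHom, back_eq_zero o ε x (by simpa using h)]
    rfl
  comm i := by
    rw [dNext_eq _ (show (ComplexShape.up ℤ).Rel i (i + 1) from rfl),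
      prevD_eq _ (show (ComplexShape.up ℤ).Rel (i - 1) i from by simp)]
    ext f : 2
    have := diff_back_add_back_diff o hε x i f
    rw [eq_sub_iff_add_eq] at this
    refine this.symm.trans ?_
    rw [add_comm (D.diff o ε (i - 1) i _)]
    rfl

/-- The action of a dot on homology. -/
noncomputable def homologyDot (i : ℤ) (e : D.Edge) : Module.End ℤ (D.Okh o ε hε i) :=
  (HomologicalComplex.homologyMap (dotMap hε e) i).hom

lemma homologyDot_mul (i : ℤ) (e e' : D.Edge) : homologyDot hε i e * homologyDot hε i e' =
    (HomologicalComplex.homologyMap (dotMap hε e' ≫ dotMap hε e) i).hom := by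
  rw [HomologicalComplex.homologyMap_comp]
  rfl

lemma homologyDot_anticommute (i : ℤ) (e e' : D.Edge) :
    homologyDot hε i e * homologyDot hε i e' = -(homologyDot hε i e' * homologyDot hε i e) := by
  have : dotMap hε e' ≫ dotMap hε e = -(dotMap hε e ≫ dotMap hε e') := by
    ext j f : 3
    exact dot_dot e e' j f
  rw [homologyDot_mul, homologyDot_mul, this, HomologicalComplex.homologyMap_neg]
  rfl

lemma homologyDot_mul_self (i : ℤ) (e : D.Edge) : homologyDot hε i e * homologyDot hε i e = 0 := by
  have : dotMap hε e ≫ dotMap hε e = 0 := by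
    ext j f : 3
    exact dot_dot_self e j f
  rw [homologyDot_mul, this, HomologicalComplex.homologyMap_zero]
  rfl

/-- The turned arrow runs between the two over edges, so the homotopy at x relates exactly these;
the arrow only decides its direction. -/
lemma homologyDot_over (i : ℤ) (x : Fin D.n) :
    homologyDot hε i (D.edge x 1) = homologyDot hε i (D.edge x 3) := by
  have := congrArg ModuleCat.Hom.hom ((dotHomotopy hε x).homologyMap_eq i)
  unfold rotHeadEdge rotTailEdge at this
  cases hx : o x
  · rw [hx] at this
    exact this
  · rw [hx] at this
    exact this.symm

lemma homologyDot_over_add_over (i : ℤ) (x : Fin D.n) :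
    homologyDot hε i (D.edge x 1) + homologyDot hε i (D.edge x 3) =
      homologyDot hε i (D.edge x 0) + homologyDot hε i (D.edge x 2) := by
  have : dotMap hε (D.edge x 1) + dotMap hε (D.edge x 3) =
      dotMap hε (D.edge x 0) + dotMap hε (D.edge x 2) := by
    ext j f : 3
    exact LinearMap.congr_fun (dot_over_add_dot_over x j) f
  have := congrArg (HomologicalComplex.homologyMap · i) this
  simp only [HomologicalComplex.homologyMap_add] at this
  exact congrArg ModuleCat.Hom.hom this

/-- The action of the coloring group on homology. -/
noncomputable def colAction (i : ℤ) : D.Col →ₗ[ℤ] Module.End ℤ (D.Okh o ε hε i) :=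
  Submodule.liftQ _ (Finsupp.linearCombination ℤ (homologyDot hε i)) (by
    rw [Submodule.span_le]
    rintro _ ⟨x, rfl | rfl⟩
    · simp [homologyDot_over hε i x]
    · have := homologyDot_over_add_over hε i x
      rw [← homologyDot_over hε i x, ← two_zsmul] at this
      rw [SetLike.mem_coe, LinearMap.mem_ker, map_sub, map_sub, map_smul]
      simp only [Finsupp.linearCombination_single, one_smul]
      rw [this]
      abel)

lemma colAction_colClass (i : ℤ) (e : D.Edge) : colAction hε i (D.colClass e) = homologyDot hε i e := by
  rw [colAction, colClass, Submodule.liftQ_apply, Finsupp.linearCombination_single, one_smul]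

lemma colAction_mul_self (i : ℤ) (c : D.Col) : colAction hε i c * colAction hε i c = 0 := by
  obtain ⟨v, rfl⟩ := Submodule.Quotient.mk_surjective _ c
  rw [colAction, Submodule.liftQ_apply]
  exact ExteriorAlgebra.linearCombination_mul_self _ (homologyDot_anticommute hε i)
    (homologyDot_mul_self hε i) v

/-- The action of the exterior algebra of the coloring group on homology. -/
noncomputable def exteriorAction (i : ℤ) :
    ExteriorAlgebra ℤ D.Col →ₐ[ℤ] Module.End ℤ (D.Okh o ε hε i) :=
  ExteriorAlgebra.lift ℤ ⟨colAction hε i, colAction_mul_self hε i⟩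

lemma exteriorAction_ι (i : ℤ) (c : D.Col) :
    exteriorAction hε i (ExteriorAlgebra.ι ℤ c) = colAction hε i c :=
  ExteriorAlgebra.lift_ι_apply ..

end LinkDiagram

theorem theorem5 (D : LinkDiagram) (o : Fin D.n → Bool) (ε : D.State → Fin D.n → ℤˣ)
    (hε : D.IsValidSign o ε) :
    ∃ Φ : D.Edge → (D.oddKhovanovComplex o ε hε ⟶ D.oddKhovanovComplex o ε hε),
      (∀ (e : D.Edge) (i : ℤ), ((Φ e).f i).hom = D.dot e i) ∧
      ∃ _ : ∀ i : ℤ, Module (ExteriorAlgebra ℤ D.Col) (D.Okh o ε hε i),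
        ∀ (i : ℤ) (e : D.Edge) (z : D.Okh o ε hε i),
          ExteriorAlgebra.ι ℤ (D.colClass e) • z =
            (HomologicalComplex.homologyMap (Φ e) i).hom z := by
  refine ⟨LinkDiagram.dotMap hε, fun e i => rfl, fun i =>
    Module.compHom (D.Okh o ε hε i) (LinkDiagram.exteriorAction hε i).toRingHom, fun i e z => ?_⟩
  change LinkDiagram.exteriorAction hε i (ExteriorAlgebra.ι ℤ (D.colClass e)) z = _
  rw [LinkDiagram.exteriorAction_ι, LinkDiagram.colAction_colClass]
  rfl
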